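/- **Setting.** Let $\Delta$ be a reduced, prime, alternating, oriented knot diagram with $n\ge 1$ crossings, with a base point. Reduced means that no region of $\Delta$ meets itself across a crossing; prime means that any closed curve which meets $\Delta$ in exactly two points, transversally and away from the crossings, has no crossing on one of its sides. *Augmented Dehn presentation.* $\mathcal A_\Delta=\langle X_0,\dots,X_{n+1}\mid R_1,\dots,R_n\rangle$ has one generator for each of the $n+2$ regions of $\Delta$ and one relator $X_aX_b^{-1}X_cX_d^{-1}$ for each crossing, where $a,b,c,d$ are the regions at the top left, top right, bottom right and bottom left when the overcrossing strand is drawn vertically. Its standard 2-complex has one vertex, one directed edge of length $1$ for each generator, and one 2-cell for each relator. A relator is drawn as a unit square with labelled, directed sides, up to rotation and reflection. *Peripheral complex.* Walk along the knot from the base point and let $c_1,\dots,c_{2n}$ be the crossings in the order in which they are met, starting with the first undercrossing. Draw $c_1$ with the walk going from left to right along the undercrossing strand, with regions $a,b,c,d$ as above. Place a relator square $C_1$ of $c_1$ with bottom left corner $(0,0)$, so that the path along its bottom and right sides spells either $X_aX_b^{-1}$ or $X_dX_c^{-1}$; so (bottom, right, top, left) has the labels $(a,b,c,d)$ or $(d,c,b,a)$.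 Given $C_k$, glue to its right side a relator square $C_{k+1}$ of $c_{k+1}$, along the side with the same label and preserving the direction. The row $C_1\cdots C_{2n}$ is a fundamental block. The peripheral complex is the tiling of the plane in which the unit square with bottom left corner $(i,j)\in\mathbb Z^2$ is $C_{k+1}$, where $0\le k<2n$ and $k\equiv i+j \pmod{2n}$. **Lemma.** For every choice of base point, orientation and position of $C_1$, a fundamental block exists, and for every such block its copies fit together along all common sides (in label and direction). The resulting peripheral complex of $\Delta$ embeds geodesically in the standard 2-complex of $\mathcal A_\Delta$, in the following sense: there is a cellular map from the peripheral complex to the universal cover of the standard 2-complex (the Cayley complex of $\mathcal A_\Delta$) which preserves the labels and directions of edges and takes each relator square to a 2-cell of the relator of its crossing, which is injective on vertices, edges and 2-cells, and which takes every geodesic edge-path of the peripheral complex to a geodesic edge-path. In particular, the word labelling any geodesic edge-path in the peripheral complex is a geodesic word in $\mathcal A_\Delta$: no word representing the same group element has fewer letters. (Here an edge travelled along its direction contributes the generator which is its label, and an edge travelled against it the inverse of that generator.) -/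

import Mathlib

/-! ## Combinatorial 2-complexes and edge-paths -/

/-- Travelling the steps `p` one after the other from the vertex `u` ends at the vertex `v`.
A step `(e, true)` runs along the directed edge `e`, a step `(e, false)` runs against it. -/
def IsEdgePath {V E : Type} (src tgt : E → V) : V → List (E × Bool) → V → Prop
  | u, [], v => u = v
  | u, (e, true) :: p, v => src e = u ∧ IsEdgePath src tgt (tgt e) p v
  | u, (e, false) :: p, v => tgt e = u ∧ IsEdgePath src tgt (src e) p v

/-- A combinatorial 2-complex: vertices, directed edges, and 2-cells attached along closed
edge-paths. All edges have unit length. -/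
structure TwoComplex where
  V : Type
  E : Type
  F : Type
  src : E → V
  tgt : E → V
  bdry : F → List (E × Bool)
  bdry_closed : ∀ f, ∃ v, IsEdgePath src tgt v (bdry f) v

/-- The inverse of a list of signed letters (or of an edge-path): reverse it and change
every sign. This is `FreeGroup.invRev`. -/
abbrev invWord {X : Type} (w : List (X × Bool)) : List (X × Bool) := FreeGroup.invRev w

/-- Apply a map to the letters of a signed word and keep the signs. -/
def mapWord {X Y : Type} (f : X → Y) (w : List (X × Bool)) : List (Y × Bool) :=
  w.map fun s => (f s.1, s.2)

namespace TwoComplex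

/-- `p` is an edge-path from `u` to `v`. -/
def IsPath (K : TwoComplex) (u : K.V) (p : List (K.E × Bool)) (v : K.V) : Prop :=
  IsEdgePath K.src K.tgt u p v

/-- `p` is a geodesic edge-path from `u` to `v`: no edge-path from `u` to `v` is shorter. -/
def IsGeodesic (K : TwoComplex) (u : K.V) (p : List (K.E × Bool)) (v : K.V) : Prop :=
  K.IsPath u p v ∧ ∀ q, K.IsPath u q v → p.length ≤ q.length

/-- A cellular map: it sends vertices to vertices, edges to edges (with their directions), and
2-cells to 2-cells. The boundary of a 2-cell goes to the boundary of the image 2-cell, where the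
boundary path may start at another vertex and may run in the other direction. -/
structure Hom (K L : TwoComplex) where
  onV : K.V → L.V
  onE : K.E → L.E
  onF : K.F → L.F
  src_onE : ∀ e, L.src (onE e) = onV (K.src e)
  tgt_onE : ∀ e, L.tgt (onE e) = onV (K.tgt e)
  bdry_onF : ∀ f, mapWord onE (K.bdry f) ~r L.bdry (onF f) ∨
    mapWord onE (K.bdry f) ~r invWord (L.bdry (onF f))

/-- An embedding of 2-complexes: injective on vertices, on edges and on 2-cells. -/
def Hom.IsEmbedding {K L : TwoComplex} (f : Hom K L) : Prop :=
  Function.Injective f.onV ∧ Function.Injective f.onE ∧ Function.Injective f.onF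

/-- A geodesic embedding: an embedding under which every geodesic edge-path of the source
stays geodesic in the target. -/
def Hom.IsGeodesicEmbedding {K L : TwoComplex} (f : Hom K L) : Prop :=
  f.IsEmbedding ∧
    ∀ u p v, K.IsGeodesic u p v → L.IsGeodesic (f.onV u) (mapWord f.onE p) (f.onV v)

end TwoComplex

/-! ## Group presentations and their 2-complexes -/

section Presentation

variable {X ι : Type} (r : ι → List (X × Bool))

/-- The group `⟨X | r i, i ∈ ι⟩`. -/
abbrev PresGroup : Type := PresentedGroup (Set.range fun i => FreeGroup.mk (r i))

/-- The element of the group that a word represents. -/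
def wordValue (w : List (X × Bool)) : PresGroup r :=
  PresentedGroup.mk (Set.range fun i => FreeGroup.mk (r i)) (FreeGroup.mk w)

/-- A word is geodesic if no word representing the same group element is shorter. -/
def IsGeodesicWord (w : List (X × Bool)) : Prop :=
  ∀ w' : List (X × Bool), wordValue r w' = wordValue r w → w.length ≤ w'.length

/-- The standard 2-complex: one vertex, one directed edge for each generator, and one 2-cell for
each defining relator, attached along the loop that spells the relator. -/
def standardComplex : TwoComplex where
  V := Unit
  E := X
  F := ι
  src _ := ()
  tgt _ := ()
  bdry := r
  bdry_closed f := ⟨(), by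
    generalize r f = w
    induction w with
    | nil => rfl
    | cons s w ih => rcases s with ⟨x, _ | _⟩ <;> exact ⟨rfl, ih⟩⟩

/-- The path that starts at the group element `g` and spells the word `w`. The edge `(h, x)` is
the edge labelled `x` from `h` to `h * x`. -/
def liftPath : PresGroup r → List (X × Bool) → List ((PresGroup r × X) × Bool)
  | _, [] => []
  | g, (x, true) :: w => ((g, x), true) :: liftPath (g * wordValue r [(x, true)]) w
  | g, (x, false) :: w =>
      ((g * (wordValue r [(x, true)])⁻¹, x), false) ::
        liftPath (g * (wordValue r [(x, true)])⁻¹) w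

theorem wordValue_cons_true (x : X) (w : List (X × Bool)) :
    wordValue r ((x, true) :: w) = wordValue r [(x, true)] * wordValue r w := by
  rw [wordValue, wordValue, wordValue, ← map_mul, FreeGroup.mul_mk]; rfl

theorem wordValue_cons_false (x : X) (w : List (X × Bool)) :
    wordValue r ((x, false) :: w) = (wordValue r [(x, true)])⁻¹ * wordValue r w := by
  rw [wordValue, wordValue, wordValue, ← map_inv, ← map_mul, FreeGroup.inv_mk,
    FreeGroup.mul_mk]; rfl

theorem isEdgePath_liftPath (g : PresGroup r) (w : List (X × Bool)) :
    IsEdgePath (fun e : PresGroup r × X => e.1)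
      (fun e => e.1 * wordValue r [(e.2, true)]) g (liftPath r g w) (g * wordValue r w) := by
  induction w generalizing g with
  | nil =>
      have h : wordValue r ([] : List (X × Bool)) = 1 := map_one _
      simp [liftPath, IsEdgePath, h]
  | cons s w ih =>
      rcases s with ⟨x, _ | _⟩
      · rw [wordValue_cons_false, ← mul_assoc]
        exact ⟨by simp, ih _⟩
      · rw [wordValue_cons_true, ← mul_assoc]
        exact ⟨rfl, ih _⟩

theorem wordValue_relator (i : ι) : wordValue r (r i) = 1 :=
  PresentedGroup.one_of_mem ⟨i, rfl⟩

/-- The universal cover of the standard 2-complex (the Cayley complex): the vertices are the group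
elements, the edge `(g, x)` runs from `g` to `g * x` and lies over the edge `x`, and the 2-cell
`(g, i)` is attached along the path from `g` that spells the relator `r i`. -/
def cayleyComplex : TwoComplex where
  V := PresGroup r
  E := PresGroup r × X
  F := PresGroup r × ι
  src e := e.1
  tgt e := e.1 * wordValue r [(e.2, true)]
  bdry f := liftPath r f.1 (r f.2)
  bdry_closed f := ⟨f.1, by
    have h := isEdgePath_liftPath r f.1 (r f.2)
    rwa [wordValue_relator, mul_one] at h⟩

theorem mapWord_liftPath (g : PresGroup r) (w : List (X × Bool)) :
    mapWord Prod.snd (liftPath r g w) = w := by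
  induction w generalizing g with
  | nil => rfl
  | cons s w ih =>
      rcases s with ⟨x, _ | _⟩ <;> simpa [mapWord, liftPath] using ih _

/-- The covering projection from the universal cover to the standard 2-complex. -/
def coveringMap : TwoComplex.Hom (cayleyComplex r) (standardComplex r) where
  onV _ := ()
  onE e := e.2
  onF f := f.2
  src_onE _ := rfl
  tgt_onE _ := rfl
  bdry_onF f := Or.inl (by
    change mapWord Prod.snd (liftPath r f.1 (r f.2)) ~r r f.2
    rw [mapWord_liftPath])

end Presentation

/-! ## Tilings of the plane by squares with labelled, directed sides -/

/-- A unit square in the plane with labelled and directed sides. A side with label `x` carries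
`(x, true)` if it points right or up, and `(x, false)` if it points left or down. -/
structure Square (X : Type) where
  bottom : X × Bool
  right : X × Bool
  top : X × Bool
  left : X × Bool

/-- The word read counterclockwise around the square from its bottom left corner. -/
def Square.boundaryWord {X : Type} (s : Square X) : List (X × Bool) :=
  [s.bottom, s.right, (s.top.1, !s.top.2), (s.left.1, !s.left.2)]

/-- `s` is a drawing of the relator square of the word `w`, up to rotation and reflection. -/
def Square.IsRelatorSquare {X : Type} (s : Square X) (w : List (X × Bool)) : Prop :=
  s.boundaryWord ~r w ∨ s.boundaryWord ~r invWord w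

/-- The unit edges of the integer grid: `horiz i j` joins `(i, j)` to `(i + 1, j)`, and
`vert i j` joins `(i, j)` to `(i, j + 1)`. -/
inductive GridEdge
  | horiz (i j : ℤ)
  | vert (i j : ℤ)

/-- The left or lower end of a grid edge. -/
def GridEdge.low : GridEdge → ℤ × ℤ
  | .horiz i j => (i, j)
  | .vert i j => (i, j)

/-- The right or upper end of a grid edge. -/
def GridEdge.high : GridEdge → ℤ × ℤ
  | .horiz i j => (i + 1, j)
  | .vert i j => (i, j + 1)

section Tiling

/- `T i j` is the square with bottom left corner `(i, j)`. -/
variable {X : Type} (T : ℤ → ℤ → Square X)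

/-- Neighbouring squares have the same label and the same direction on their common side. -/
def TilesFit : Prop :=
  ∀ i j, (T i j).right = (T (i + 1) j).left ∧ (T i j).top = (T i (j + 1)).bottom

/-- The label and direction of a grid edge. -/
def gridSide : GridEdge → X × Bool
  | .horiz i j => (T i j).bottom
  | .vert i j => (T i j).left

/-- The step along a grid edge to the right or up. -/
def forwardStep (e : GridEdge) : GridEdge × Bool := (e, (gridSide T e).2)

/-- The step along a grid edge to the left or down. -/
def backwardStep (e : GridEdge) : GridEdge × Bool := (e, !(gridSide T e).2)

/-- The 2-complex of a tiling: the vertices are the integer points, the edges are the grid edges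
with the directions that the squares give them, and the 2-cells are the squares. -/
def tilingComplex : TwoComplex where
  V := ℤ × ℤ
  E := GridEdge
  F := ℤ × ℤ
  src e := if (gridSide T e).2 then e.low else e.high
  tgt e := if (gridSide T e).2 then e.high else e.low
  bdry f := [forwardStep T (.horiz f.1 f.2), forwardStep T (.vert (f.1 + 1) f.2),
    backwardStep T (.horiz f.1 (f.2 + 1)), backwardStep T (.vert f.1 f.2)]
  bdry_closed f := ⟨f, by
    obtain ⟨i, j⟩ := f
    simp only [forwardStep, backwardStep]
    cases h1 : (gridSide T (.horiz i j)).2 <;>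
      cases h2 : (gridSide T (.vert (i + 1) j)).2 <;>
      cases h3 : (gridSide T (.horiz i (j + 1))).2 <;>
      cases h4 : (gridSide T (.vert i j)).2 <;>
      simp [IsEdgePath, GridEdge.low, GridEdge.high, h1, h2, h3, h4]⟩

/-- The word labelling an edge-path in the tiling: an edge travelled in its direction contributes
its label, an edge travelled against its direction the inverse of its label. -/
def pathWord (p : List (GridEdge × Bool)) : List (X × Bool) :=
  mapWord (fun e => (gridSide T e).1) p

end Tiling

/-! ## Knot diagrams -/

/-- The half-edges of a diagram with `n` crossings. The half-edges `(c, 0), (c, 1), (c, 2), (c, 3)`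
leave the crossing `c` in counterclockwise order. The strand made of `(c, 0)` and `(c, 2)` passes
under the strand made of `(c, 1)` and `(c, 3)`. -/
abbrev HalfEdge (n : ℕ) : Type := Fin n × ZMod 4

/-- Turn each half-edge counterclockwise by `k` quarter turns around its crossing. -/
def turn {n : ℕ} (k : ZMod 4) : Equiv.Perm (HalfEdge n) :=
  (Equiv.refl (Fin n)).prodCongr (Equiv.addRight k)

/-- The half-edge belongs to the lower strand of its crossing. -/
def HalfEdge.IsUnder {n : ℕ} (d : HalfEdge n) : Prop := d.2 = 0 ∨ d.2 = 2

/-- A diagram with `n` crossings as a combinatorial map: `glue` matches the two half-edges of each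
edge. Together with the counterclockwise orders at the crossings this determines a cellular
diagram on a closed oriented surface. -/
structure DiagramMap (n : ℕ) where
  glue : HalfEdge n → HalfEdge n
  glue_glue : Function.Involutive glue
  glue_ne : ∀ d, glue d ≠ d

namespace DiagramMap

variable {n : ℕ} (D : DiagramMap n)

/-- Follow the link: the half-edge `d` leads away from its crossing; walk along its edge, go
straight through the next crossing, and return the half-edge by which that crossing is left. -/
def walk : Equiv.Perm (HalfEdge n) := D.glue_glue.toPerm.trans (turn 2)

/-- The corner `(c, i)` at a crossing lies between the half-edges `(c, i)` and `(c, i + 1)`, that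
is, on the left of the half-edge `(c, i)` leading away from `c`. This map sends a corner of a
region to the next corner of the same region: walk along the edge with the region on the left. -/
def nextCorner : Equiv.Perm (HalfEdge n) := D.glue_glue.toPerm.trans (turn (-1))

/-- The regions of the diagram: the cycles of corners. -/
def Region : Type := Quotient (Equiv.Perm.SameCycle.setoid D.nextCorner)

/-- The region at a corner; equivalently the region on the left of the half-edge `d` leading away
from its crossing. The region on its right is `D.region (D.glue d)`. -/
def region (d : HalfEdge n) : D.Region := Quotient.mk _ d

end DiagramMap

/-- A knot diagram with `n ≥ 1` crossings on the plane (or the sphere). -/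
structure KnotDiagram (n : ℕ) extends DiagramMap n where
  /-- There is only one link component: every half-edge is passed, in one of the two directions,
  on the walk that starts with any given half-edge. -/
  one_component : ∀ d d', toDiagramMap.walk.SameCycle d d' ∨
    toDiagramMap.walk.SameCycle d (glue d')
  /-- The surface is the sphere: there are `n` vertices and `2 * n` edges, so the Euler
  characteristic is `2` exactly if there are `n + 2` regions. -/
  planar : Nat.card toDiagramMap.Region = n + 2

namespace KnotDiagram

variable {n : ℕ} (D : KnotDiagram n)

/-- Alternating: every edge leads from an undercrossing to an overcrossing. -/
def IsAlternating : Prop := ∀ d : HalfEdge n, (D.glue d).IsUnder ↔ ¬ d.IsUnder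

/-- Reduced: there is no nugatory crossing, i.e. no region that meets itself across a crossing
(so that no closed curve in the plane meets the diagram only in a crossing, crossing both
strands there). -/
def IsReduced : Prop := ∀ (c : Fin n) (i : ZMod 4), D.region (c, i) ≠ D.region (c, i + 2)

/-- Prime: a closed curve that meets the diagram in exactly two points, transversally and away
from the crossings, has no crossing on one of its sides. Such a curve runs through the two regions
next to each of the two edges which it meets; so the condition says that the edges are the same
as soon as the regions on their two sides are. -/
def IsPrime : Prop := ∀ d d' : HalfEdge n, D.region d = D.region d' →
  D.region (D.glue d) = D.region (D.glue d') → d' = d ∨ d' = D.glue d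

/-- The relator `X_a X_b⁻¹ X_c X_d⁻¹` of a crossing, where, with the overcrossing strand drawn
vertically, `a`, `b`, `c`, `d` are the regions at the top left, top right, bottom right and bottom
left. -/
def relator (c : Fin n) : List (D.Region × Bool) :=
  [(D.region (c, 1), true), (D.region (c, 0), false), (D.region (c, 3), true),
    (D.region (c, 2), false)]

/-- The walk along the knot that leaves its first crossing by the half-edge `e`: the half-edge by
which it leaves the `(k + 1)`-st crossing `c_{k+1}` that it meets. -/
def exitAt (e : HalfEdge n) (k : ℕ) : HalfEdge n := (D.walk ^ k) e

/-- The two positions of the first square, for a walk that leaves its first crossing by `e`,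
after passing under it. Draw the crossing with the walk going from left to right, and let `a`,
`b`, `c`, `d` be its regions at the top left, top right, bottom right and bottom left. The path
along the bottom and then the right side of the square spells `X_a X_b⁻¹` or `X_d X_c⁻¹`, a loop
that goes down on the one side of the overcrossing strand and comes up on the other side. -/
def firstSquares (e : HalfEdge n) : Set (Square D.Region) :=
  let a := D.region (turn 1 e)
  let b := D.region e
  let c := D.region (turn 3 e)
  let d := D.region (turn 2 e)
  {⟨(a, true), (b, false), (c, false), (d, true)⟩,
    ⟨(d, true), (c, false), (b, false), (a, true)⟩}

/-- `C 0, …, C (2 * n - 1)` are the squares of a fundamental block that starts with the square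
`S`: the `k`-th one is a relator square of the crossing met by the walk at that time, and the left
side of each square has the same label and the same direction as the right side of its
predecessor. The values `C k` for `k ≥ 2 * n` do not matter. -/
structure IsFundamentalBlock (e : HalfEdge n) (S : Square D.Region)
    (C : ℕ → Square D.Region) : Prop where
  first : C 0 = S
  relatorSquare : ∀ k < 2 * n, (C k).IsRelatorSquare (D.relator (D.exitAt e k).1)
  glued : ∀ k, k + 1 < 2 * n → (C (k + 1)).left = (C k).right

/-- The position in the fundamental block, counted from `0`, of the square with bottom left corner
`(i, j)`: each horizontal strip of the plane is a line of copies of the block, and every strip is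
shifted against the strip below it by one square to the left. -/
def blockIndex (n : ℕ) (i j : ℤ) : ℕ := ((i + j) % (2 * n : ℤ)).toNat

/-- The tiling of the plane by copies of the fundamental block `C`. -/
def peripheralTiling (C : ℕ → Square D.Region) (i j : ℤ) : Square D.Region :=
  C (blockIndex n i j)

/-- The peripheral complex. -/
def peripheralComplex (C : ℕ → Square D.Region) : TwoComplex :=
  tilingComplex (D.peripheralTiling C)

end KnotDiagram

/-! The standard 2-complex of the augmented Dehn presentation is a complex of squares with one
vertex. By alternation, the corners of a region lie either all on the left of outgoing lower
half-edges or all on the left of outgoing upper half-edges (`IsAlternating.exists_color`). This is a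
checkerboard colouring, and it makes the link of the vertex bipartite; by primality the link has no
double edges (`linkCondition_relator`). So the complex is nonpositively curved.

In such a complex a word is geodesic as soon as pushing subwords across squares never produces a
letter next to its inverse (`IsReducedWord.isGeodesicWord`). For the proof the universal cover is
built by hand: its vertices are the classes of reduced words up to pushing across squares, and the
generators act on them by cancelling or prepending a letter (`ReducedClass.act`). The relators act
trivially because two different first letters of a class always span a square. The relation
`SquareEquiv` has this property by definition, and the absence of triangles in the link makes it
transitive.

A plane of relator squares in which opposite edges at a vertex have different letters has a 4-cycle
as the link of each vertex, and without triangles such a cycle has no chords. Therefore the path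
along a horizontal and then a vertical line has a reduced word (`exists_reduced_quadrantPath`). Any
two vertices of the plane are joined by such a path, which gives injectivity and geodesics at once
(`exists_isGeodesicEmbedding`).

Finally, a relator square is determined by its crossing and its left side, since the regions that
face each other across a crossing are different (`IsReduced.eq_tile`). Hence the fundamental block
consists of explicit squares, alternately reflected, and is periodic as the walk has period
`2 * n` (`walk_pow_two_mul`). -/

/-! ### Words up to pushing across squares -/

/-- The inverse letter. -/
def flipLetter {X : Type} (s : X × Bool) : X × Bool := (s.1, !s.2)

@[simp] theorem flipLetter_flipLetter {X : Type} (s : X × Bool) :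
    flipLetter (flipLetter s) = s := by
  simp [flipLetter]

/-- A system of squares on the letters of `X`, where `Q s t a b` says that there is a square with
the two boundary paths `s a` and `t b` between opposite corners, so that `s` and `t` are the letters
leaving one corner. The link at a vertex is the graph on the letters with an edge between `s` and
`t` for each such square. By `symm` and `rot` every corner of a square gives an edge; the other
conditions say that the link has no double edges, no loops and no triangles, that is, that the
squares form a nonpositively curved complex. -/
structure LinkCondition {X : Type} (Q : X × Bool → X × Bool → X × Bool → X × Bool → Prop) :
    Prop where
  symm : ∀ {s t a b}, Q s t a b → Q t s b a
  rot : ∀ {s t a b}, Q s t a b → Q (flipLetter s) a t (flipLetter b)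
  uniq : ∀ {s t a b a' b'}, Q s t a b → Q s t a' b' → a = a' ∧ b = b'
  ne : ∀ {s t a b}, Q s t a b → s ≠ t
  no_triangle : ∀ {s t u a b c d e f}, Q s t a b → Q t u c d → Q u s e f → False

section Words

variable {X : Type} (Q : X × Bool → X × Bool → X × Bool → X × Bool → Prop)

/-- Equality of words up to pushing subwords across squares. Instead of the closure of the
elementary moves this is a relation by recursion on the length: the words have the same first
letter and related tails, or their first letters span a square through whose opposite corner both
words can be led. -/
inductive SquareEquiv : List (X × Bool) → List (X × Bool) → Prop
  | nil : SquareEquiv [] []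
  | cons (s : X × Bool) {u v : List (X × Bool)} (h : SquareEquiv u v) :
      SquareEquiv (s :: u) (s :: v)
  | square {s t a b : X × Bool} {u v z : List (X × Bool)} (hQ : Q s t a b)
      (hu : SquareEquiv u (a :: z)) (hv : SquareEquiv v (b :: z)) :
      SquareEquiv (s :: u) (t :: v)

/-- The letter `s` starts some word equivalent to `w`. -/
def IsFirstLetter (w : List (X × Bool)) (s : X × Bool) : Prop :=
  ∃ u, SquareEquiv Q w (s :: u)

/-- Read from its end, the word never meets a letter whose inverse starts some word equivalent to
the part already read; that is, no equivalent word contains a letter next to its inverse. -/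
def IsReducedWord : List (X × Bool) → Prop
  | [] => True
  | s :: w => IsReducedWord w ∧ ¬ IsFirstLetter Q w (flipLetter s)

variable {Q}

/-- The square seen from the corner opposite to the one between `s` and `t`. -/
theorem LinkCondition.opposite (H : LinkCondition Q) {s t a b : X × Bool} (h : Q s t a b) :
    Q (flipLetter a) (flipLetter b) (flipLetter s) (flipLetter t) :=
  H.rot (H.symm (H.rot h))

namespace SquareEquiv

theorem refl (w : List (X × Bool)) : SquareEquiv Q w w := by
  induction w with
  | nil => exact .nil
  | cons s w ih => exact .cons s ih

theorem symm (H : LinkCondition Q) {u v : List (X × Bool)} (h : SquareEquiv Q u v) :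
    SquareEquiv Q v u := by
  induction h with
  | nil => exact .nil
  | cons s _ ih => exact .cons s ih
  | square hQ hu hv _ _ => exact .square (H.symm hQ) hv hu

theorem length_eq {u v : List (X × Bool)} (h : SquareEquiv Q u v) : u.length = v.length := by
  induction h with
  | nil => rfl
  | cons s _ ih => simp [ih]
  | square hQ hu hv ihu ihv => simp_all

/-- Two consecutive squares at the same corner either coincide, and then cancel, or complete a
triangle in the link. -/
theorem trans (H : LinkCondition Q) {u v w : List (X × Bool)} (h : SquareEquiv Q u v)
    (h' : SquareEquiv Q v w) : SquareEquiv Q u w := by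
  induction hn : u.length generalizing u v w with
  | zero =>
    cases h with
    | nil => exact h'
    | cons => simp at hn
    | square => simp at hn
  | succ n ih =>
    cases h with
    | nil => simp at hn
    | cons s h1 =>
      simp only [List.length_cons, Nat.add_right_cancel_iff] at hn
      cases h' with
      | cons _ h2 => exact .cons s (ih h1 h2 hn)
      | square hQ h2 h3 => exact .square hQ (ih h1 h2 hn) h3
    | square hQ h1 h2 =>
      rename_i s t a b u v z
      simp only [List.length_cons, Nat.add_right_cancel_iff] at hn
      have hv : v.length = n := by
        rw [h2.length_eq, List.length_cons, ← hn, h1.length_eq, List.length_cons]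
      have hz : (b :: z).length = n := by rw [← h2.length_eq, hv]
      cases h' with
      | cons _ h3 => exact .square hQ h1 (ih (h3.symm H) h2 (by rw [← h3.length_eq, hv]))
      | square hQ' h3 h4 =>
        rename_i r b' c w z'
        have hb := ih (h2.symm H) h3 hz
        cases hb with
        | cons _ hzz =>
          -- both squares have the corner between `flipLetter t` and `b`
          obtain ⟨rfl, e2⟩ := H.uniq (H.rot (H.symm hQ)) (H.rot hQ')
          obtain rfl : a = c := by simpa using congrArg flipLetter e2
          have := ih h1 (.cons a hzz) hn
          exact .cons _ (ih this (h4.symm H) hn)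
        | square hQ'' h5 h6 =>
          exact (H.no_triangle (H.rot hQ') (H.symm hQ'') (H.symm (H.rot (H.symm hQ)))).elim

theorem cons_inj (H : LinkCondition Q) {s : X × Bool} {u v : List (X × Bool)}
    (h : SquareEquiv Q (s :: u) (s :: v)) : SquareEquiv Q u v := by
  cases h with
  | cons _ h => exact h
  | square hQ _ _ => exact (H.ne hQ rfl).elim

end SquareEquiv

theorem IsFirstLetter.of_equiv (H : LinkCondition Q) {u v : List (X × Bool)} {s : X × Bool}
    (h : IsFirstLetter Q u s) (e : SquareEquiv Q u v) : IsFirstLetter Q v s :=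
  h.imp fun _ hw => (e.symm H).trans H hw

/-- If `s` and `t` span a square and `t` starts some word equivalent to `s :: w`, then this comes
from pushing across that square, as it is the only one at the corner. -/
theorem IsFirstLetter.of_cons (H : LinkCondition Q) {s t a b : X × Bool} {w : List (X × Bool)}
    (h : IsFirstLetter Q (s :: w) t) (hQ : Q s t a b) : IsFirstLetter Q w a := by
  obtain ⟨u, hu⟩ := h
  cases hu with
  | cons => exact (H.ne hQ rfl).elim
  | square hQ' h1 h2 =>
    obtain ⟨rfl, rfl⟩ := H.uniq hQ hQ'
    exact ⟨_, h1⟩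

/-- Pushing a path across a square. -/
theorem IsFirstLetter.cons {s t a b : X × Bool} {w : List (X × Bool)}
    (h : IsFirstLetter Q w a) (hQ : Q s t a b) : IsFirstLetter Q (s :: w) t := by
  obtain ⟨u, hu⟩ := h
  exact ⟨b :: u, .square hQ hu (.refl _)⟩

/-- Being reduced depends only on the class of a word. -/
theorem IsReducedWord.of_equiv (H : LinkCondition Q) {u v : List (X × Bool)}
    (h : IsReducedWord Q u) (e : SquareEquiv Q u v) : IsReducedWord Q v := by
  induction hn : u.length generalizing u v with
  | zero =>
    cases e with
    | nil => exact h
    | cons => simp at hn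
    | square => simp at hn
  | succ n ih =>
    cases e with
    | nil => exact h
    | cons s e =>
      simp only [List.length_cons, Nat.add_right_cancel_iff] at hn
      exact ⟨ih h.1 e hn, fun h' => h.2 (h'.of_equiv H (e.symm H))⟩
    | square hQ h1 h2 =>
      rename_i s t a b u v z
      simp only [List.length_cons, Nat.add_right_cancel_iff] at hn
      obtain ⟨hz, ha⟩ := ih h.1 h1 hn
      have hs : ¬ IsFirstLetter Q (a :: z) (flipLetter s) :=
        fun h' => h.2 (h'.of_equiv H (h1.symm H))
      have hb : IsReducedWord Q (b :: z) :=
        ⟨hz, fun h' => hs (h'.cons (H.symm (H.rot hQ)))⟩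
      refine ⟨ih hb (h2.symm H) ?_, fun h' => ?_⟩
      · rw [← hn, h1.length_eq, List.length_cons, List.length_cons]
      · exact ha ((h'.of_equiv H h2).of_cons H (H.symm (H.rot (H.symm hQ))))

end Words

/-! ### The action on classes of reduced words -/

section States

variable {X : Type} {Q : X × Bool → X × Bool → X × Bool → X × Bool → Prop}

/-- Reduced words up to pushing subwords across squares. These are the vertices of the universal
cover, each given by the geodesics to a base vertex. -/
def reducedSetoid (H : LinkCondition Q) : Setoid {w // IsReducedWord Q w} where
  r u v := SquareEquiv Q u.1 v.1
  iseqv := ⟨fun _ => .refl _, fun h => h.symm H, fun h h' => h.trans H h'⟩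

/-- The classes of reduced words. -/
abbrev ReducedClass (H : LinkCondition Q) : Type := Quotient (reducedSetoid H)

namespace ReducedClass

variable (H : LinkCondition Q)

/-- The class of a reduced word. -/
def ofWord (w : List (X × Bool)) (hw : IsReducedWord Q w) : ReducedClass H :=
  Quotient.mk (reducedSetoid H) ⟨w, hw⟩

variable {H}

theorem exists_ofWord (W : ReducedClass H) : ∃ w hw, W = ofWord H w hw := by
  obtain ⟨⟨w, hw⟩, rfl⟩ := Quotient.exists_rep W
  exact ⟨w, hw, rfl⟩

theorem ofWord_eq {u v : List (X × Bool)} (hu : IsReducedWord Q u) (hv : IsReducedWord Q v) :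
    ofWord H u hu = ofWord H v hv ↔ SquareEquiv Q u v :=
  Quotient.eq (r := reducedSetoid H)

/-- The number of letters of the words in a class. -/
def length (W : ReducedClass H) : ℕ :=
  Quotient.lift (s := reducedSetoid H) (fun w => w.1.length) (fun _ _ h => h.length_eq) W

@[simp] theorem length_ofWord (w : List (X × Bool)) (hw : IsReducedWord Q w) :
    (ofWord H w hw).length = w.length := rfl

open Classical in
/-- Left multiplication by a letter: cancel it against a first letter of the class if possible,
and prepend it otherwise. One of the two is always possible, see `cancel_or_prepend`; the last branch
only makes the definition total. -/
noncomputable def act (s : X × Bool) (W : ReducedClass H) : ReducedClass H :=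
  if h : ∃ u, ∃ hu : IsReducedWord Q (flipLetter s :: u), W = ofWord H _ hu then
    ofWord H h.choose h.choose_spec.choose.1
  else if h' : ∃ u, ∃ hu : IsReducedWord Q (s :: u), W = ofWord H u hu.1 then
    ofWord H _ h'.choose_spec.choose
  else W

theorem act_cancel (s : X × Bool) {u : List (X × Bool)} (hu : IsReducedWord Q (flipLetter s :: u)) :
    act s (ofWord H _ hu) = ofWord H u hu.1 := by
  have h : ∃ v, ∃ hv : IsReducedWord Q (flipLetter s :: v), ofWord H _ hu = ofWord H _ hv :=
    ⟨u, hu, rfl⟩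
  rw [act, dif_pos h, ofWord_eq]
  exact ((ofWord_eq _ _).1 h.choose_spec.choose_spec).cons_inj H |>.symm H

theorem act_prepend (s : X × Bool) {u : List (X × Bool)} (hu : IsReducedWord Q (s :: u)) :
    act s (ofWord H u hu.1) = ofWord H _ hu := by
  have h : ¬ ∃ v, ∃ hv : IsReducedWord Q (flipLetter s :: v), ofWord H u hu.1 = ofWord H _ hv := by
    rintro ⟨v, hv, e⟩
    exact hu.2 ⟨v, (ofWord_eq _ _).1 e⟩
  have h' : ∃ v, ∃ hv : IsReducedWord Q (s :: v), ofWord H u hu.1 = ofWord H v hv.1 :=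
    ⟨u, hu, rfl⟩
  rw [act, dif_neg h, dif_pos h', ofWord_eq]
  exact .cons s (((ofWord_eq _ _).1 h'.choose_spec.choose_spec).symm H)

/-- Either the letter cancels or it can be prepended. -/
theorem cancel_or_prepend (s : X × Bool) (W : ReducedClass H) :
    (∃ u, ∃ hu : IsReducedWord Q (flipLetter s :: u), W = ofWord H _ hu) ∨
      ∃ u, ∃ hu : IsReducedWord Q (s :: u), W = ofWord H u hu.1 := by
  obtain ⟨w, hw, rfl⟩ := W.exists_ofWord
  by_cases h : IsFirstLetter Q w (flipLetter s)
  · obtain ⟨u, hu⟩ := h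
    exact .inl ⟨u, hw.of_equiv H hu, (ofWord_eq _ _).2 hu⟩
  · exact .inr ⟨w, ⟨hw, h⟩, rfl⟩

theorem act_flipLetter_act (s : X × Bool) (W : ReducedClass H) :
    act (flipLetter s) (act s W) = W := by
  rcases cancel_or_prepend s W with ⟨u, hu, rfl⟩ | ⟨u, hu, rfl⟩
  · rw [act_cancel, act_prepend]
  · have hu' : IsReducedWord Q (flipLetter (flipLetter s) :: u) := by simpa using hu
    rw [act_prepend s hu]
    have := act_cancel (H := H) (flipLetter s) hu'
    simpa using this

theorem length_act_le (s : X × Bool) (W : ReducedClass H) :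
    (act s W).length ≤ W.length + 1 := by
  rcases cancel_or_prepend s W with ⟨u, hu, rfl⟩ | ⟨u, hu, rfl⟩
  · rw [act_cancel]
    simp only [length_ofWord, List.length_cons]
    omega
  · rw [act_prepend s hu]
    simp

/-- For a square with the sides `s a` and `t b`: if `b` does not cancel against `w`, then `s`
does not cancel against `a :: w`. -/
theorem not_isFirstLetter_of_opposite (H : LinkCondition Q) {s t a b : X × Bool} (hQ : Q s t a b)
    {w : List (X × Bool)} (hw : ¬ IsFirstLetter Q w (flipLetter b)) :
    ¬ IsFirstLetter Q (a :: w) (flipLetter s) :=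
  fun h => hw (h.of_cons H (H.symm (H.rot hQ)))

/-- The two sides `s a` and `t b` of a square act in the same way. -/
theorem act_square {s t a b : X × Bool} (hQ : Q s t a b) (W : ReducedClass H) :
    act s (act a W) = act t (act b W) := by
  obtain ⟨w, hw, rfl⟩ := W.exists_ofWord
  -- the case that exactly one of the letters `a` and `b` cancels
  have mixed : ∀ {s t a b : X × Bool}, Q s t a b → ∀ w hw, IsFirstLetter Q w (flipLetter a) →
      ¬ IsFirstLetter Q w (flipLetter b) →
      act s (act a (ofWord H w hw)) = act t (act b (ofWord H w hw)) := by
    rintro s t a b hQ w hw ⟨u, hu⟩ hb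
    have hau : IsReducedWord Q (flipLetter a :: u) := hw.of_equiv H hu
    have hs : IsReducedWord Q (s :: u) := ⟨hau.1, fun h => hb <|
      (h.cons (H.opposite hQ)).of_equiv H (hu.symm H)⟩
    have hbw : IsReducedWord Q (b :: w) := ⟨hw, hb⟩
    have e : SquareEquiv Q (b :: w) (flipLetter t :: s :: u) := by
      have hq := H.symm (H.rot (H.symm hQ))
      exact .square hq hu (.refl _)
    have ht : IsReducedWord Q (flipLetter t :: s :: u) := hbw.of_equiv H e
    rw [(ofWord_eq hw hau).2 hu, act_cancel, act_prepend s hs, ← (ofWord_eq hw hau).2 hu,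
      act_prepend b hbw, (ofWord_eq hbw ht).2 e, act_cancel]
  by_cases ha : IsFirstLetter Q w (flipLetter a) <;> by_cases hb : IsFirstLetter Q w (flipLetter b)
  · -- two first letters of `w` span a square, which can only be the given one
    obtain ⟨u, hu⟩ := ha
    obtain ⟨v, hv⟩ := hb
    have hau : IsReducedWord Q (flipLetter a :: u) := hw.of_equiv H hu
    have hbv : IsReducedWord Q (flipLetter b :: v) := hw.of_equiv H hv
    have e := (hu.symm H).trans H hv
    have hab := H.opposite hQ
    obtain ⟨z, hz, hz'⟩ : ∃ z, SquareEquiv Q u (flipLetter s :: z) ∧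
        SquareEquiv Q v (flipLetter t :: z) := by
      generalize hA : flipLetter a = A at *
      generalize hB : flipLetter b = B at *
      cases e with
      | cons => exact (H.ne hab rfl).elim
      | square hQ' h1 h2 =>
        obtain ⟨rfl, rfl⟩ := H.uniq hQ' hab
        exact ⟨_, h1, h2⟩
    have hsz : IsReducedWord Q (flipLetter s :: z) := hau.1.of_equiv H hz
    have htz : IsReducedWord Q (flipLetter t :: z) := hbv.1.of_equiv H hz'
    rw [(ofWord_eq hw hau).2 hu, act_cancel, (ofWord_eq hau.1 hsz).2 hz, act_cancel,
      ← (ofWord_eq hw hau).2 hu, (ofWord_eq hw hbv).2 hv, act_cancel,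
      (ofWord_eq hbv.1 htz).2 hz', act_cancel]
  · exact mixed hQ w hw ha hb
  · exact (mixed (H.symm hQ) w hw hb ha).symm
  · have h1 : IsReducedWord Q (s :: a :: w) :=
      ⟨⟨hw, ha⟩, not_isFirstLetter_of_opposite H hQ hb⟩
    have h2 : IsReducedWord Q (t :: b :: w) :=
      ⟨⟨hw, hb⟩, not_isFirstLetter_of_opposite H (H.symm hQ) ha⟩
    rw [act_prepend a h1.1, act_prepend s h1, act_prepend b h2.1, act_prepend t h2, ofWord_eq]
    exact .square hQ (.refl _) (.refl _)

variable (H) in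
/-- Left multiplication by a generator. -/
noncomputable def genPerm (x : X) : Equiv.Perm (ReducedClass H) where
  toFun := act (x, true)
  invFun := act (x, false)
  left_inv := act_flipLetter_act (x, true)
  right_inv := act_flipLetter_act (x, false)

variable (H) in
theorem lift_genPerm (w : List (X × Bool)) (W : ReducedClass H) :
    FreeGroup.lift (genPerm H) (FreeGroup.mk w) W = w.foldr act W := by
  rw [FreeGroup.lift_mk]
  induction w with
  | nil => rfl
  | cons s w ih =>
    rcases s with ⟨x, _ | _⟩ <;>
      rw [List.map_cons, List.prod_cons, Equiv.Perm.mul_apply, ih] <;> rfl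

theorem foldr_act_nil {w : List (X × Bool)} (hw : IsReducedWord Q w) :
    w.foldr act (ofWord H [] trivial) = ofWord H w hw := by
  induction w with
  | nil => rfl
  | cons s w ih => rw [List.foldr_cons, ih hw.1, act_prepend s hw]

theorem length_foldr_act_le (w : List (X × Bool)) :
    (w.foldr act (ofWord H [] trivial)).length ≤ w.length := by
  induction w with
  | nil => exact le_rfl
  | cons s w ih =>
    rw [List.foldr_cons, List.length_cons]
    exact (length_act_le _ _).trans (by omega)

end ReducedClass

end States

section PresentedBySquares

variable {X ι : Type} (r : ι → List (X × Bool))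

/-- The squares that are drawings of the relators: bottom `s`, right `a`, top `b`, left `t`. -/
def RelatorCorner (s t a b : X × Bool) : Prop :=
  ∃ i, (Square.mk s a b t).IsRelatorSquare (r i)

variable {r}

/-- Reduced words are geodesic: the group acts on the classes of reduced words, a reduced word takes
the class of the empty word to its own class, and no shorter word does, because a letter changes
the length by at most one. -/
theorem IsReducedWord.isGeodesicWord (H : LinkCondition (RelatorCorner r))
    (hr : ∀ i, (r i).length = 4) {w : List (X × Bool)}
    (hw : IsReducedWord (RelatorCorner r) w) : IsGeodesicWord r w := by
  have hrel : ∀ g ∈ Set.range fun i => FreeGroup.mk (r i),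
      FreeGroup.lift (ReducedClass.genPerm H) g = 1 := by
    rintro _ ⟨i, rfl⟩
    obtain ⟨s, a, b, t, hi⟩ : ∃ s a b t, r i = [s, a, b, t] := List.length_eq_four.1 (hr i)
    have hQ : RelatorCorner r s (flipLetter t) a (flipLetter b) :=
      ⟨i, Or.inl (by rw [hi]; simp [Square.boundaryWord, flipLetter, List.IsRotated.refl])⟩
    ext1 W
    simp only [hi]
    rw [ReducedClass.lift_genPerm]
    simp only [List.foldr_cons, List.foldr_nil, Equiv.Perm.coe_one, id]
    rw [ReducedClass.act_square hQ]
    have h1 := fun W => ReducedClass.act_flipLetter_act (H := H) t W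
    have h2 := fun W => ReducedClass.act_flipLetter_act (H := H) b W
    rw [h2, h1]
  intro w' hw'
  have key : ∀ v, PresentedGroup.toGroup hrel (wordValue r v)
      (ReducedClass.ofWord H [] trivial) = v.foldr ReducedClass.act (.ofWord H [] trivial) :=
    fun v => ReducedClass.lift_genPerm H v _
  have h1 := key w
  rw [ReducedClass.foldr_act_nil hw, ← hw', key w'] at h1
  have h2 := ReducedClass.length_foldr_act_le (H := H) w'
  rw [h1] at h2
  simpa using h2

end PresentedBySquares

/-! ### Words, lifted paths and relator squares -/

section WordValues

variable {X ι : Type} (r : ι → List (X × Bool))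

theorem wordValue_append (u v : List (X × Bool)) :
    wordValue r (u ++ v) = wordValue r u * wordValue r v := by
  rw [wordValue, wordValue, wordValue, ← map_mul, FreeGroup.mul_mk]

theorem wordValue_cons (s : X × Bool) (w : List (X × Bool)) :
    wordValue r (s :: w) = wordValue r [s] * wordValue r w :=
  wordValue_append r [s] w

theorem wordValue_invWord (w : List (X × Bool)) :
    wordValue r (invWord w) = (wordValue r w)⁻¹ := by
  rw [wordValue, wordValue, ← map_inv, FreeGroup.inv_mk]

theorem wordValue_flipLetter (s : X × Bool) :
    wordValue r [flipLetter s] = (wordValue r [s])⁻¹ :=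
  wordValue_invWord r [s]

theorem liftPath_cons (g : PresGroup r) (s : X × Bool) (w : List (X × Bool)) :
    liftPath r g (s :: w) = liftPath r g [s] ++ liftPath r (g * wordValue r [s]) w := by
  rcases s with ⟨x, _ | _⟩
  · have : wordValue r [(x, false)] = (wordValue r [(x, true)])⁻¹ :=
      wordValue_flipLetter r (x, true)
    rw [this]; rfl
  · rfl

theorem liftPath_append (g : PresGroup r) (u v : List (X × Bool)) :
    liftPath r g (u ++ v) = liftPath r g u ++ liftPath r (g * wordValue r u) v := by
  induction u generalizing g with
  | nil =>
    have : wordValue r ([] : List (X × Bool)) = 1 := map_one _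
    simp [liftPath, this]
  | cons s u ih =>
    rw [List.cons_append, liftPath_cons, ih, liftPath_cons r g s u, wordValue_cons r s u,
      List.append_assoc, mul_assoc]

theorem invWord_append {Y : Type} (u v : List (Y × Bool)) :
    invWord (u ++ v) = invWord v ++ invWord u := by
  simp [invWord, FreeGroup.invRev]

theorem liftPath_invWord (g : PresGroup r) (w : List (X × Bool)) :
    liftPath r (g * wordValue r w) (invWord w) = invWord (liftPath r g w) := by
  induction w generalizing g with
  | nil => rfl
  | cons s w ih =>
    have h : invWord (s :: w) = invWord w ++ [flipLetter s] := invWord_append [s] w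
    have h' : ∀ g, liftPath r (g * wordValue r [s]) [flipLetter s] = invWord (liftPath r g [s]) := by
      intro g
      rcases s with ⟨x, _ | _⟩
      · have : wordValue r [(x, false)] = (wordValue r [(x, true)])⁻¹ :=
          wordValue_flipLetter r (x, true)
        simp [liftPath, flipLetter, invWord, FreeGroup.invRev, this]
      · simp [liftPath, flipLetter, invWord, FreeGroup.invRev]
    rw [h, liftPath_cons, invWord_append, wordValue_cons, ← mul_assoc, liftPath_append, ih,
      wordValue_invWord, mul_inv_cancel_right, h']

theorem exists_liftPath_isRotated (g : PresGroup r) {u w : List (X × Bool)} (h : u ~r w)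
    (hu : wordValue r u = 1) : ∃ g', liftPath r g u ~r liftPath r g' w := by
  obtain ⟨n, rfl⟩ := h
  rw [List.rotate_eq_drop_append_take_mod]
  generalize n % u.length = m
  refine ⟨g * wordValue r (u.take m), ?_⟩
  have h1 := liftPath_append r g (u.take m) (u.drop m)
  rw [List.take_append_drop] at h1
  have h2 := wordValue_append r (u.take m) (u.drop m)
  rw [List.take_append_drop, hu] at h2
  rw [h1, liftPath_append, mul_assoc, ← h2, mul_one]
  exact List.isRotated_append

end WordValues

section RelatorCorners

variable {X ι : Type} {r : ι → List (X × Bool)}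

theorem Square.boundaryWord_transpose (s a b t : X × Bool) :
    (Square.mk t b a s).boundaryWord = invWord (Square.mk s a b t).boundaryWord := by
  simp [Square.boundaryWord, invWord, FreeGroup.invRev]

theorem List.IsRotated.invWord {u v : List (X × Bool)} (h : u ~r v) :
    invWord u ~r _root_.invWord v :=
  (h.map _).reverse

theorem Square.IsRelatorSquare.transpose {s a b t : X × Bool} {w : List (X × Bool)}
    (h : (Square.mk s a b t).IsRelatorSquare w) : (Square.mk t b a s).IsRelatorSquare w := by
  rw [Square.IsRelatorSquare, Square.boundaryWord_transpose]
  rcases h with h | h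
  · exact .inr h.invWord
  · exact .inl (by simpa [FreeGroup.invRev_invRev] using h.invWord)

theorem Square.IsRelatorSquare.quarterTurn {s a b t : X × Bool} {w : List (X × Bool)}
    (h : (Square.mk s a b t).IsRelatorSquare w) :
    (Square.mk a (flipLetter b) t (flipLetter s)).IsRelatorSquare w := by
  have e : (Square.mk a (flipLetter b) t (flipLetter s)).boundaryWord ~r
      (Square.mk s a b t).boundaryWord :=
    ⟨3, by simp [Square.boundaryWord, flipLetter]⟩
  exact h.imp e.trans e.trans

theorem RelatorCorner.symm {s t a b : X × Bool} (h : RelatorCorner r s t a b) :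
    RelatorCorner r t s b a :=
  h.imp fun _ hi => hi.transpose

theorem RelatorCorner.rot {s t a b : X × Bool} (h : RelatorCorner r s t a b) :
    RelatorCorner r (flipLetter s) a t (flipLetter b) :=
  h.imp fun _ hi => hi.quarterTurn.transpose

end RelatorCorners

/-! ### Paths in an immersed plane of relator squares -/

section Plane

variable {X ι : Type} {r : ι → List (X × Bool)}

/-- The letter of the horizontal step from `(i, j)`, to the right if `p` is true and to the left
otherwise. -/
def horizLetter (T : ℤ → ℤ → Square X) (p : Bool) (i j : ℤ) : X × Bool :=
  if p then (T i j).bottom else flipLetter (T (i - 1) j).bottom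

/-- The letter of the vertical step from `(i, j)`, upwards if `q` is true and downwards
otherwise. -/
def vertLetter (T : ℤ → ℤ → Square X) (q : Bool) (i j : ℤ) : X × Bool :=
  if q then (T i j).left else flipLetter (T i (j - 1)).left

/-- The unit with the given sign. -/
def unitStep (p : Bool) : ℤ := if p then 1 else -1

/-- Prepending a step of a monotone path in the plane. The letters `C` and `D` leave the new vertex
into the quadrant of the path, `A` and `B` leave the old one. A square that changes the first
letter `C` into one other than `D` would complete a triangle in the link of the old vertex. -/
theorem IsReducedWord.prepend {Q : X × Bool → X × Bool → X × Bool → X × Bool → Prop}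
    (H : LinkCondition Q) {A B C D b x y : X × Bool} {w : List (X × Bool)}
    (hw : IsReducedWord Q w) (hfirst : ∀ s, IsFirstLetter Q w s → s = A ∨ s = B)
    (hAB : Q A B x y) (hCD : Q C D B b) (hA : flipLetter C ≠ A) :
    IsReducedWord Q (C :: w) ∧ ∀ s, IsFirstLetter Q (C :: w) s → s = C ∨ s = D := by
  refine ⟨⟨hw, fun h => ?_⟩, ?_⟩
  · rcases hfirst _ h with h | h
    · exact hA h
    · exact H.ne (H.rot hCD) h
  · rintro s ⟨u, hu⟩
    cases hu with
    | cons => exact .inl rfl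
    | square hQ h1 h2 =>
      rename_i a b' z
      have hQ' := H.rot hQ
      rcases hfirst _ ⟨_, h1⟩ with rfl | rfl
      · exact (H.no_triangle hAB (H.symm (H.rot hCD)) hQ').elim
      · exact .inr (H.uniq hQ' (H.rot hCD)).1

variable {T : ℤ → ℤ → Square X} {c : ℤ → ℤ → ι}

/-- The square of the plane in each of the four quadrants at a vertex. -/
theorem relatorCorner_plane (hfit : TilesFit T) (hsq : ∀ i j, (T i j).IsRelatorSquare (r (c i j)))
    (p q : Bool) (i j : ℤ) :
    RelatorCorner r (horizLetter T p i j) (vertLetter T q i j)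
      (vertLetter T q (i + unitStep p) j) (horizLetter T p i (j + unitStep q)) := by
  have key : ∀ i j, RelatorCorner r (T i j).bottom (T i j).left (T (i + 1) j).left
      (T i (j + 1)).bottom := by
    intro i j
    rw [← (hfit i j).1, ← (hfit i j).2]
    exact ⟨_, hsq i j⟩
  have e1 : i - 1 + 1 = i := by ring
  have e2 : j - 1 + 1 = j := by ring
  cases p <;> cases q <;> simp only [horizLetter, vertLetter, unitStep, if_true, if_false,
    Bool.false_eq_true, ← sub_eq_add_neg]
  · have := key (i - 1) (j - 1)
    rw [e1, e2] at this
    exact this.rot.symm.rot.symm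
  · have := key (i - 1) j
    rw [e1] at this
    exact this.rot
  · have := key i (j - 1)
    rw [e2] at this
    exact this.symm.rot.symm
  · exact key i j

variable (T) in
/-- The horizontal step from `(i, j)`. -/
def horizStep (p : Bool) (i j : ℤ) : GridEdge × Bool :=
  if p then forwardStep T (.horiz i j) else backwardStep T (.horiz (i - 1) j)

variable (T) in
/-- The vertical step from `(i, j)`. -/
def vertStep (q : Bool) (i j : ℤ) : GridEdge × Bool :=
  if q then forwardStep T (.vert i j) else backwardStep T (.vert i (j - 1))

theorem isPath_forwardStep_cons (e : GridEdge) {P : List (GridEdge × Bool)} {v : ℤ × ℤ}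
    (h : (tilingComplex T).IsPath e.high P v) :
    (tilingComplex T).IsPath e.low (forwardStep T e :: P) v := by
  unfold TwoComplex.IsPath forwardStep at *
  cases hs : (gridSide T e).2 <;> simp [IsEdgePath, tilingComplex, hs] <;> exact h

theorem isPath_backwardStep_cons (e : GridEdge) {P : List (GridEdge × Bool)} {v : ℤ × ℤ}
    (h : (tilingComplex T).IsPath e.low P v) :
    (tilingComplex T).IsPath e.high (backwardStep T e :: P) v := by
  unfold TwoComplex.IsPath backwardStep at *
  cases hs : (gridSide T e).2 <;> simp [IsEdgePath, tilingComplex, hs] <;> exact h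

theorem isPath_horizStep_cons (p : Bool) {i j : ℤ} {P : List (GridEdge × Bool)} {v : ℤ × ℤ}
    (h : (tilingComplex T).IsPath (i + unitStep p, j) P v) :
    (tilingComplex T).IsPath (i, j) (horizStep T p i j :: P) v := by
  cases p
  · have := isPath_backwardStep_cons (T := T) (.horiz (i - 1) j) h
    simpa [GridEdge.high, horizStep] using this
  · exact isPath_forwardStep_cons (T := T) (.horiz i j) h

theorem isPath_vertStep_cons (q : Bool) {i j : ℤ} {P : List (GridEdge × Bool)} {v : ℤ × ℤ}
    (h : (tilingComplex T).IsPath (i, j + unitStep q) P v) :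
    (tilingComplex T).IsPath (i, j) (vertStep T q i j :: P) v := by
  cases q
  · have := isPath_backwardStep_cons (T := T) (.vert i (j - 1)) h
    simpa [GridEdge.high, vertStep] using this
  · exact isPath_forwardStep_cons (T := T) (.vert i j) h

theorem pathWord_cons (s : GridEdge × Bool) (P : List (GridEdge × Bool)) :
    pathWord T (s :: P) = ((gridSide T s.1).1, s.2) :: pathWord T P := rfl

theorem pathWord_horizStep_cons (p : Bool) (i j : ℤ) (P : List (GridEdge × Bool)) :
    pathWord T (horizStep T p i j :: P) = horizLetter T p i j :: pathWord T P := by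
  cases p <;> rfl

theorem pathWord_vertStep_cons (q : Bool) (i j : ℤ) (P : List (GridEdge × Bool)) :
    pathWord T (vertStep T q i j :: P) = vertLetter T q i j :: pathWord T P := by
  cases q <;> rfl

/-- At each vertex of the plane, opposite edges have different letters. Edges at a right angle have
different letters anyway, as they span a square. -/
structure IsImmersed (T : ℤ → ℤ → Square X) : Prop where
  horiz : ∀ i j, (T i j).bottom ≠ flipLetter (T (i - 1) j).bottom
  vert : ∀ i j, (T i j).left ≠ flipLetter (T i (j - 1)).left

theorem IsImmersed.horizLetter_ne (him : IsImmersed T) (p : Bool) (i j : ℤ) :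
    flipLetter (horizLetter T p i j) ≠ horizLetter T p (i + unitStep p) j := by
  intro h
  cases p
  · have e : i + -1 - 1 = i - 1 - 1 := by ring
    simp only [horizLetter, unitStep, Bool.false_eq_true, if_false, flipLetter_flipLetter, e] at h
    exact him.horiz _ _ h
  · have := him.horiz (i + 1) j
    rw [add_sub_cancel_right] at this
    exact this h.symm

theorem IsImmersed.vertLetter_ne (him : IsImmersed T) (q : Bool) (i j : ℤ) :
    flipLetter (vertLetter T q i j) ≠ vertLetter T q i (j + unitStep q) := by
  intro h
  cases q
  · have e : j + -1 - 1 = j - 1 - 1 := by ring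
    simp only [vertLetter, unitStep, Bool.false_eq_true, if_false, flipLetter_flipLetter, e] at h
    exact him.vert _ _ h
  · have := him.vert i (j + 1)
    rw [add_sub_cancel_right] at this
    exact this h.symm

/-- In every quadrant, the path along a horizontal and then a vertical line has a reduced word. The
induction carries along that its first letter can only be changed to the letter of the other edge
into the quadrant. -/
theorem exists_reduced_quadrantPath (H : LinkCondition (RelatorCorner r)) (hfit : TilesFit T)
    (hsq : ∀ i j, (T i j).IsRelatorSquare (r (c i j))) (him : IsImmersed T) (p q : Bool)
    (m k : ℕ) (i j : ℤ) :
    ∃ P : List (GridEdge × Bool),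
      (tilingComplex T).IsPath (i, j) P (i + unitStep p * m, j + unitStep q * k) ∧
      IsReducedWord (RelatorCorner r) (pathWord T P) ∧
      ∀ s, IsFirstLetter (RelatorCorner r) (pathWord T P) s →
        s = horizLetter T p i j ∨ s = vertLetter T q i j := by
  have hQ := relatorCorner_plane (r := r) hfit hsq p q
  induction m generalizing i with
  | zero =>
    induction k generalizing j with
    | zero =>
      refine ⟨[], ?_, trivial, ?_⟩
      · show (i, j) = _
        simp
      · rintro s ⟨u, hu⟩
        cases hu
    | succ k ih =>
      obtain ⟨P, hP, hred, hfirst⟩ := ih (j + unitStep q)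
      have := hred.prepend H (fun s hs => (hfirst s hs).symm) (H.symm (hQ i _)) (H.symm (hQ i j))
        (him.vertLetter_ne q i j)
      refine ⟨vertStep T q i j :: P, isPath_vertStep_cons q ?_, ?_⟩
      · rwa [Nat.cast_succ, mul_add, mul_one, add_comm (_ * _), ← add_assoc]
      · rw [pathWord_vertStep_cons]
        exact ⟨this.1, fun s hs => (this.2 s hs).symm⟩
  | succ m ih =>
    obtain ⟨P, hP, hred, hfirst⟩ := ih (i + unitStep p)
    refine ⟨horizStep T p i j :: P, isPath_horizStep_cons p ?_, ?_⟩
    · rwa [Nat.cast_succ, mul_add (unitStep p), mul_one, add_comm (_ * (m : ℤ)), ← add_assoc]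
    · rw [pathWord_horizStep_cons]
      exact hred.prepend H hfirst (hQ _ j) (hQ i j) (him.horizLetter_ne p i j)

theorem exists_reduced_path (H : LinkCondition (RelatorCorner r)) (hfit : TilesFit T)
    (hsq : ∀ i j, (T i j).IsRelatorSquare (r (c i j))) (him : IsImmersed T) (u v : ℤ × ℤ) :
    ∃ P : List (GridEdge × Bool),
      (tilingComplex T).IsPath u P v ∧ IsReducedWord (RelatorCorner r) (pathWord T P) := by
  have hsign : ∀ x : ℤ, ∃ p, ∃ m : ℕ, x = unitStep p * m := by
    intro x
    rcases Int.eq_nat_or_neg x with ⟨m, rfl | rfl⟩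
    · exact ⟨true, m, by simp [unitStep]⟩
    · exact ⟨false, m, by simp [unitStep]⟩
  obtain ⟨p, m, hm⟩ := hsign (v.1 - u.1)
  obtain ⟨q, k, hk⟩ := hsign (v.2 - u.2)
  obtain ⟨P, hP, hred, -⟩ := exists_reduced_quadrantPath H hfit hsq him p q m k u.1 u.2
  refine ⟨P, ?_, hred⟩
  rw [← hm, ← hk] at hP
  simpa using hP

/-! ### The map to the Cayley complex -/

/-- Partial products of a two-sided sequence, as the orbit of a permutation of `ℤ × G`. -/
theorem exists_partial_products {G : Type} [Group G] (a : ℤ → G) (x : G) :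
    ∃ h : ℤ → G, h 0 = x ∧ ∀ i, h (i + 1) = h i * a i := by
  let σ : Equiv.Perm (ℤ × G) :=
    { toFun := fun y => (y.1 + 1, y.2 * a y.1)
      invFun := fun y => (y.1 - 1, y.2 * (a (y.1 - 1))⁻¹)
      left_inv := fun y => by simp
      right_inv := fun y => by simp }
  have h1 : ∀ n : ℤ, ((σ ^ (n + 1)) (0, x)) = σ ((σ ^ n) (0, x)) := by
    intro n
    rw [add_comm, zpow_add, zpow_one, Equiv.Perm.mul_apply]
  have h2 : ∀ n : ℤ, ((σ ^ n) (0, x)).1 = n := by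
    intro n
    induction n using Int.induction_on with
    | zero => rfl
    | succ n ih => rw [h1]; exact congrArg (· + 1) ih
    | pred n ih =>
      have e := h1 (-n - 1)
      rw [sub_add_cancel] at e
      rw [e] at ih
      have : ((σ ^ (-(n : ℤ) - 1)) (0, x)).1 + 1 = -n := ih
      omega
  refine ⟨fun n => ((σ ^ n) (0, x)).2, rfl, fun n => ?_⟩
  show ((σ ^ (n + 1)) (0, x)).2 = _
  rw [h1]
  show _ * a _ = _
  rw [h2]

/-- The squares of the plane commute in the group, so the plane maps to the Cayley graph. -/
theorem exists_vertexMap (hfit : TilesFit T) (hsq : ∀ i j, (T i j).IsRelatorSquare (r (c i j))) :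
    ∃ g : ℤ × ℤ → PresGroup r, ∀ e, g e.high = g e.low * wordValue r [gridSide T e] := by
  have hcomm : ∀ i j, wordValue r [(T i j).bottom] * wordValue r [(T (i + 1) j).left] =
      wordValue r [(T i j).left] * wordValue r [(T i (j + 1)).bottom] := by
    intro i j
    have h : wordValue r (T i j).boundaryWord = 1 := by
      have hrot : ∀ {u v : List (X × Bool)}, u ~r v → wordValue r v = 1 → wordValue r u = 1 := by
        rintro u _ ⟨n, rfl⟩ h
        rw [List.rotate_eq_drop_append_take_mod, wordValue_append, mul_eq_one_iff_eq_inv] at h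
        rw [← List.take_append_drop (n % u.length) u, wordValue_append, h, mul_inv_cancel]
      rcases hsq i j with h | h
      · exact hrot h (wordValue_relator r _)
      · exact hrot h (by rw [wordValue_invWord, wordValue_relator, inv_one])
    have e : (T i j).boundaryWord = [(T i j).bottom] ++ [(T i j).right] ++
      invWord ([(T i j).left] ++ [(T i j).top]) := rfl
    rw [e, wordValue_append, wordValue_invWord, wordValue_append, wordValue_append,
      mul_inv_eq_one] at h
    rwa [← (hfit i j).1, ← (hfit i j).2]
  obtain ⟨h, -, hh⟩ := exists_partial_products (fun i => wordValue r [(T i 0).bottom]) 1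
  choose k hk0 hk using fun i => exists_partial_products (fun j => wordValue r [(T i j).left]) (h i)
  refine ⟨fun v => k v.1 v.2, ?_⟩
  rintro (⟨i, j⟩ | ⟨i, j⟩)
  · show k (i + 1) j = k i j * wordValue r [(T i j).bottom]
    have step : ∀ j, k (i + 1) j = k i j * wordValue r [(T i j).bottom] ↔
        k (i + 1) (j + 1) = k i (j + 1) * wordValue r [(T i (j + 1)).bottom] := by
      intro j
      rw [hk, hk, mul_assoc, ← hcomm, ← mul_assoc, mul_left_inj]
    induction j using Int.induction_on with
    | zero => rw [hk0, hk0, hh]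
    | succ j ih => exact (step _).1 ih
    | pred j ih => exact (step _).2 (by rwa [sub_add_cancel])
  · exact hk i j

end Plane

section Embedding

variable {X ι : Type} {r : ι → List (X × Bool)} {T : ℤ → ℤ → Square X} {c : ℤ → ℤ → ι}

theorem gridEdge_ext_of_ends {e e' : GridEdge}
    (h : (e.low = e'.low ∧ e.high = e'.high) ∨ (e.low = e'.high ∧ e.high = e'.low)) : e = e' := by
  rcases e with ⟨i, j⟩ | ⟨i, j⟩ <;> rcases e' with ⟨i', j'⟩ | ⟨i', j'⟩ <;>
    simp only [GridEdge.low, GridEdge.high, Prod.mk.injEq] at h <;>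
    first
      | (exfalso; omega)
      | (obtain ⟨rfl, rfl⟩ : i = i' ∧ j = j' := by omega
         rfl)

theorem tilingComplex_ends (e : GridEdge) :
    ((tilingComplex T).src e = e.low ∧ (tilingComplex T).tgt e = e.high) ∨
      ((tilingComplex T).src e = e.high ∧ (tilingComplex T).tgt e = e.low) := by
  cases h : (gridSide T e).2 <;> simp [tilingComplex, h]

theorem gridEdge_ext_of_src_tgt {e e' : GridEdge}
    (hs : (tilingComplex T).src e = (tilingComplex T).src e')
    (ht : (tilingComplex T).tgt e = (tilingComplex T).tgt e') : e = e' := by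
  refine gridEdge_ext_of_ends ?_
  rcases tilingComplex_ends (T := T) e with ⟨h1, h2⟩ | ⟨h1, h2⟩ <;>
    rcases tilingComplex_ends (T := T) e' with ⟨h3, h4⟩ | ⟨h3, h4⟩ <;>
    rw [h1, h3] at hs <;> rw [h2, h4] at ht
  · exact .inl ⟨hs, ht⟩
  · exact .inr ⟨hs, ht⟩
  · exact .inr ⟨ht, hs⟩
  · exact .inl ⟨ht, hs⟩

variable {g : ℤ × ℤ → PresGroup r}

variable (T g) in
/-- The edge map that covers the vertex map `g` and keeps the labels. -/
def liftEdge (e : GridEdge) : PresGroup r × X :=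
  (g ((tilingComplex T).src e), (gridSide T e).1)

theorem vertexMap_tgt (hg : ∀ e, g e.high = g e.low * wordValue r [gridSide T e])
    (e : GridEdge) : g ((tilingComplex T).tgt e) =
      g ((tilingComplex T).src e) * wordValue r [((gridSide T e).1, true)] := by
  have := hg e
  rcases h : gridSide T e with ⟨x, b⟩
  cases b
  · rw [h] at this
    have hx : wordValue r [(x, false)] = (wordValue r [(x, true)])⁻¹ :=
      wordValue_flipLetter r (x, true)
    rw [hx] at this
    simp [tilingComplex, h, this]
  · simpa [tilingComplex, h] using this

theorem mapWord_liftEdge (hg : ∀ e, g e.high = g e.low * wordValue r [gridSide T e])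
    {u v : ℤ × ℤ} {P : List (GridEdge × Bool)} (hP : (tilingComplex T).IsPath u P v) :
    mapWord (liftEdge T g) P = liftPath r (g u) (pathWord T P) ∧
      g v = g u * wordValue r (pathWord T P) := by
  induction P generalizing u with
  | nil =>
    obtain rfl : u = v := hP
    refine ⟨rfl, ?_⟩
    have : wordValue r (pathWord T []) = 1 := map_one _
    rw [this, mul_one]
  | cons s P ih =>
    obtain ⟨e, _ | _⟩ := s
    · obtain ⟨rfl, hP⟩ := hP
      obtain ⟨ih1, ih2⟩ := ih hP
      have hs : g ((tilingComplex T).tgt e) * (wordValue r [((gridSide T e).1, true)])⁻¹ =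
          g ((tilingComplex T).src e) := by
        rw [vertexMap_tgt hg, mul_inv_cancel_right]
      rw [pathWord_cons, wordValue_cons_false, ← mul_assoc, hs]
      refine ⟨?_, ih2⟩
      show _ :: mapWord _ P = _ :: _
      rw [ih1, hs]
      rfl
    · obtain ⟨rfl, hP⟩ := hP
      obtain ⟨ih1, ih2⟩ := ih hP
      have hs := vertexMap_tgt hg e
      rw [pathWord_cons, wordValue_cons_true, ← mul_assoc, ← hs]
      refine ⟨?_, ih2⟩
      show _ :: mapWord _ P = _ :: _
      rw [ih1, ← hs]
      rfl

theorem length_pathWord (P : List (GridEdge × Bool)) : (pathWord T P).length = P.length :=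
  List.length_map _

theorem tilingComplex_bdry_isPath (T : ℤ → ℤ → Square X) (i j : ℤ) :
    (tilingComplex T).IsPath (i, j) ((tilingComplex T).bdry (i, j)) (i, j) := by
  refine isPath_forwardStep_cons (.horiz i j) (isPath_forwardStep_cons (.vert (i + 1) j)
    (isPath_backwardStep_cons (.horiz i (j + 1)) (isPath_backwardStep_cons (.vert i j) rfl)))

theorem pathWord_bdry (hfit : TilesFit T) (i j : ℤ) :
    pathWord T ((tilingComplex T).bdry (i, j)) = (T i j).boundaryWord := by
  rw [Square.boundaryWord, (hfit i j).1, (hfit i j).2]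
  rfl

/-- The boundary of each square lifts to the boundary of a 2-cell of the Cayley complex, based at a
suitable corner of the square. -/
theorem exists_cell_lift (hfit : TilesFit T) (hsq : ∀ i j, (T i j).IsRelatorSquare (r (c i j)))
    (hg : ∀ e, g e.high = g e.low * wordValue r [gridSide T e]) (f : ℤ × ℤ) :
    ∃ g', mapWord (liftEdge T g) ((tilingComplex T).bdry f) ~r liftPath r g' (r (c f.1 f.2)) ∨
      mapWord (liftEdge T g) ((tilingComplex T).bdry f) ~r
        invWord (liftPath r g' (r (c f.1 f.2))) := by
  obtain ⟨i, j⟩ := f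
  obtain ⟨h1, h2⟩ := mapWord_liftEdge hg (tilingComplex_bdry_isPath T i j)
  rw [pathWord_bdry hfit] at h1 h2
  have hval := left_eq_mul.1 h2
  rw [h1]
  rcases hsq i j with h | h
  · obtain ⟨g', hg'⟩ := exists_liftPath_isRotated r (g (i, j)) h hval
    exact ⟨g', .inl hg'⟩
  · obtain ⟨g', hg'⟩ := exists_liftPath_isRotated r (g (i, j)) h hval
    have e := liftPath_invWord r g' (r (c i j))
    rw [wordValue_relator, mul_one] at e
    exact ⟨g', .inr (e ▸ hg')⟩

theorem mem_edges_of_isRotated {E : Type} {u v w : List (E × Bool)} (hu : u ~r w ∨ u ~r invWord w)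
    (hv : v ~r w ∨ v ~r invWord w) {x : E} (hx : x ∈ u.map Prod.fst) : x ∈ v.map Prod.fst := by
  have key : ∀ {u : List (E × Bool)}, u ~r w ∨ u ~r invWord w →
      (x ∈ u.map Prod.fst ↔ x ∈ w.map Prod.fst) := by
    rintro u (h | h)
    · exact (h.map _).mem_iff
    · rw [(h.map _).mem_iff]
      simp [invWord, FreeGroup.invRev]
  exact (key hv).2 ((key hu).1 hx)

/-- An immersed plane of relator squares embeds geodesically, since any two of its vertices are
joined by a path with a reduced word. -/
theorem exists_isGeodesicEmbedding (H : LinkCondition (RelatorCorner r))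
    (hr : ∀ i, (r i).length = 4) (hfit : TilesFit T)
    (hsq : ∀ i j, (T i j).IsRelatorSquare (r (c i j))) (him : IsImmersed T) :
    (∃ f : TwoComplex.Hom (tilingComplex T) (cayleyComplex r),
      (∀ x, (f.onE x).2 = (gridSide T x).1) ∧ (∀ i j, (f.onF (i, j)).2 = c i j) ∧
      f.IsGeodesicEmbedding) ∧
    ∀ u p v, (tilingComplex T).IsGeodesic u p v → IsGeodesicWord r (pathWord T p) := by
  obtain ⟨g, hg⟩ := exists_vertexMap (r := r) hfit hsq
  have hgeod : ∀ (u : ℤ × ℤ) (p : List (GridEdge × Bool)) (v : ℤ × ℤ),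
      (tilingComplex T).IsGeodesic u p v → IsGeodesicWord r (pathWord T p) := by
    intro u p v hp w hw
    obtain ⟨P, hP, hred⟩ := exists_reduced_path H hfit hsq him u v
    have h1 := (mapWord_liftEdge hg hP).2
    have h2 := (mapWord_liftEdge hg hp.1).2
    rw [h2, mul_right_inj] at h1
    have h3 := hred.isGeodesicWord H hr w (hw.trans h1)
    have h4 := hp.2 P hP
    rw [length_pathWord] at h3 ⊢
    exact h4.trans h3
  refine ⟨?_, hgeod⟩
  have hinj : Function.Injective g := by
    intro u v huv
    obtain ⟨P, hP, hred⟩ := exists_reduced_path H hfit hsq him u v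
    have h1 := (mapWord_liftEdge hg hP).2
    rw [huv] at h1
    have h2 := hred.isGeodesicWord H hr [] ((map_one _).trans (left_eq_mul.1 h1).symm)
    have h3 : P = [] := by simpa [pathWord, mapWord] using h2
    subst h3
    exact hP
  have hinjE : Function.Injective (liftEdge T g) := by
    intro e e' h
    have hs := hinj (congrArg Prod.fst h)
    refine gridEdge_ext_of_src_tgt hs (hinj ?_)
    have hl : (gridSide T e).1 = (gridSide T e').1 := congrArg Prod.snd h
    rw [vertexMap_tgt hg, vertexMap_tgt hg, hs, hl]
  choose g' hg' using exists_cell_lift hfit hsq hg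
  refine ⟨⟨g, liftEdge T g, fun f => (g' f, c f.1 f.2), fun _ => rfl,
    fun e => (vertexMap_tgt hg e).symm, hg'⟩, fun _ => rfl, fun _ _ => rfl,
    ⟨hinj, hinjE, ?_⟩, ?_⟩
  · -- the boundary edges determine a square of the grid
    have hmem : ∀ f f' : ℤ × ℤ, (g' f, c f.1 f.2) = (g' f', c f'.1 f'.2) →
        f.1 = f'.1 ∧ (f.2 = f'.2 ∨ f.2 = f'.2 + 1) := by
      intro f f' h
      have h1 := hg' f
      rw [Prod.mk.injEq] at h
      rw [h.1, h.2] at h1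
      have h2 := mem_edges_of_isRotated h1 (hg' f') (x := liftEdge T g (.horiz f.1 f.2))
        (by simp [mapWord, tilingComplex, forwardStep])
      simp only [mapWord, tilingComplex, forwardStep, backwardStep, List.map_cons, List.map_nil,
        List.mem_cons, List.not_mem_nil, or_false, hinjE.eq_iff, GridEdge.horiz.injEq,
        reduceCtorEq, false_or] at h2
      omega
    intro f f' h
    have h1 := hmem f f' h
    have h2 := hmem f' f h.symm
    exact Prod.ext h1.1 (by omega)
  · intro (u : ℤ × ℤ) (p : List (GridEdge × Bool)) (v : ℤ × ℤ) hp
    obtain ⟨h1, h2⟩ := mapWord_liftEdge hg hp.1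
    have hlen : (mapWord (liftEdge T g) p).length = p.length := List.length_map _
    refine ⟨?_, fun q hq => ?_⟩
    · show (cayleyComplex r).IsPath (g u) (mapWord (liftEdge T g) p) (g v)
      have h3 := isEdgePath_liftPath r (g u) (pathWord T p)
      rwa [← h1, ← h2] at h3
    · show (mapWord (liftEdge T g) p).length ≤ _
      -- a path in the Cayley complex spells the quotient of its ends
      have hval : ∀ (q : List ((PresGroup r × X) × Bool)) (x y : PresGroup r),
          (cayleyComplex r).IsPath x q y → y = x * wordValue r (mapWord Prod.snd q) := by
        intro q
        induction q with
        | nil =>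
          intro x y h
          obtain rfl : x = y := h
          exact (mul_one x).symm.trans (congrArg _ (map_one _).symm)
        | cons s q ih =>
          rintro x y h
          obtain ⟨⟨z, a⟩, _ | _⟩ := s
          · obtain ⟨rfl, h⟩ := h
            have := ih _ _ h
            show _ = _ * wordValue r ((a, false) :: mapWord Prod.snd q)
            rw [wordValue_cons_false, this]
            simp [cayleyComplex]
          · obtain ⟨rfl, h⟩ := h
            have := ih _ _ h
            show _ = _ * wordValue r ((a, true) :: mapWord Prod.snd q)
            rw [wordValue_cons_true, this]
            simp [cayleyComplex, mul_assoc]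
      have h3 := hval q _ _ hq
      have h4 := h2.symm.trans h3
      have h5 := hgeod u p v hp (mapWord Prod.snd q) (mul_left_cancel h4).symm
      rw [length_pathWord] at h5
      rw [hlen]
      exact h5.trans_eq (List.length_map _)

end Embedding

/-! ### Walks in knot diagrams -/

namespace DiagramMap

variable {n : ℕ} (D : DiagramMap n)

theorem walk_apply (d : HalfEdge n) : D.walk d = turn 2 (D.glue d) := rfl

theorem turn_turn (k l : ZMod 4) (d : HalfEdge n) : turn k (turn l d) = turn (l + k) d :=
  Prod.ext rfl (add_assoc _ _ _)

theorem turn_zero (d : HalfEdge n) : turn 0 d = d :=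
  Prod.ext rfl (add_zero _)

theorem turn_two_turn_two (d : HalfEdge n) : turn 2 (turn 2 d) = d := by
  rw [turn_turn]
  exact turn_zero d

theorem turn_two_ne (d : HalfEdge n) : turn 2 d ≠ d := by
  intro h
  have : d.2 + 2 = d.2 := congrArg Prod.snd h
  exact absurd (add_eq_left.1 this) (by decide)

/-- The region on the right of the half-edge `d` leading away from its crossing. -/
theorem region_glue (d : HalfEdge n) : D.region (D.glue d) = D.region (turn 3 d) := by
  refine Quotient.sound (s := Equiv.Perm.SameCycle.setoid D.nextCorner) ⟨1, ?_⟩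
  show turn (-1) (D.glue (D.glue d)) = _
  rw [D.glue_glue d]
  rfl

theorem turn_two_walk (d : HalfEdge n) : turn 2 (D.walk d) = D.glue d := by
  rw [walk_apply, turn_two_turn_two]

theorem region_turn_two_walk (d : HalfEdge n) :
    D.region (turn 2 (D.walk d)) = D.region (turn 3 d) := by
  rw [turn_two_walk, region_glue]

theorem region_turn_one_walk (d : HalfEdge n) :
    D.region (turn 1 (D.walk d)) = D.region d := by
  rw [walk_apply, turn_turn]
  exact (D.region_glue (D.glue d)).symm.trans (by rw [D.glue_glue d])

/-- The walk in the opposite direction is the inverse of the walk. -/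
theorem glue_walk_zpow (k : ℤ) (d : HalfEdge n) :
    D.glue ((D.walk ^ k) d) = (D.walk ^ (-k)) (D.glue d) := by
  have h : D.glue_glue.toPerm * D.walk * D.glue_glue.toPerm⁻¹ = D.walk⁻¹ := by
    rw [mul_inv_eq_iff_eq_mul, eq_inv_mul_iff_mul_eq]
    ext1 d
    show turn 2 (D.glue (D.glue (turn 2 (D.glue d)))) = D.glue d
    rw [D.glue_glue, turn_two_turn_two]
  have h' := congrArg (fun f : Equiv.Perm (HalfEdge n) => (f ^ k) (D.glue d)) h
  simp only [conj_zpow, inv_zpow', Equiv.Perm.mul_apply] at h'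
  rw [← h']
  have e : D.glue_glue.toPerm⁻¹ (D.glue d) = d := by
    rw [Equiv.Perm.inv_eq_iff_eq]
    rfl
  rw [e]
  rfl

/-- A walk never returns along an edge in the opposite direction: halfway it would have to turn
back inside an edge or at a crossing. -/
theorem not_sameCycle_glue (d : HalfEdge n) : ¬ D.walk.SameCycle d (D.glue d) := by
  rintro ⟨m, hm⟩
  rcases Int.even_or_odd' m with ⟨k, rfl | rfl⟩
  · refine D.glue_ne ((D.walk ^ k) d) ?_
    rw [glue_walk_zpow, ← hm, ← Equiv.Perm.mul_apply, ← zpow_add]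
    congr 2
    ring
  · refine turn_two_ne (D.glue ((D.walk ^ k) d)) ?_
    rw [← walk_apply, glue_walk_zpow, ← hm]
    simp only [← Equiv.Perm.mul_apply, ← zpow_add, ← zpow_one_add]
    congr 2
    ring

end DiagramMap

namespace KnotDiagram

open DiagramMap

variable {n : ℕ} (D : KnotDiagram n)

/-- The walk along the knot passes each of the `2 * n` edges once before it returns. -/
theorem walk_pow_two_mul (e : HalfEdge n) : (D.walk ^ (2 * n)) e = e := by
  classical
  let s : Finset (HalfEdge n) := {d | D.walk.SameCycle e d}
  have hmem : ∀ d, d ∈ s ↔ D.walk.SameCycle e d := by simp [s]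
  have hcyc : D.walk.IsCycleOn s := by
    refine ⟨⟨fun d hd => ?_, D.walk.injective.injOn, fun d hd => ?_⟩, fun x hx y hy => ?_⟩
    · exact (hmem _).2 (((hmem _).1 hd).trans ⟨1, by simp⟩)
    · exact ⟨D.walk.symm d, (hmem _).2 (((hmem _).1 hd).trans ⟨-1, by simp⟩), by simp⟩
    · exact ((hmem _).1 hx).symm.trans ((hmem _).1 hy)
  have hcompl : sᶜ = s.map D.glue_glue.toPerm.toEmbedding := by
    ext d
    have hd : d ∈ s.map D.glue_glue.toPerm.toEmbedding ↔ D.glue d ∈ s := by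
      rw [Finset.mem_map_equiv]
      rfl
    rw [hd, Finset.mem_compl, hmem, hmem]
    refine ⟨(D.one_component e d).resolve_left, fun h h' => ?_⟩
    exact D.not_sameCycle_glue d (h'.symm.trans h)
  have hcard := Finset.card_add_card_compl s
  rw [hcompl, Finset.card_map, Fintype.card_prod, Fintype.card_fin, ZMod.card] at hcard
  have h : s.card = 2 * n := by omega
  rw [← h]
  exact hcyc.pow_card_apply ((hmem e).2 (.refl _ _))

/-! ### Colours and relator squares of alternating diagrams -/

/-- The Boolean form of `HalfEdge.IsUnder`. -/
def isUnderBool (d : HalfEdge n) : Bool := decide (d.2 = 0 ∨ d.2 = 2)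

theorem isUnderBool_iff (d : HalfEdge n) : isUnderBool d = true ↔ d.IsUnder := by
  simp [isUnderBool, HalfEdge.IsUnder]

theorem isUnderBool_turn_two (d : HalfEdge n) : isUnderBool (turn 2 d) = isUnderBool d := by
  obtain ⟨c, i⟩ := d
  revert i
  show ∀ i : ZMod 4, decide (i + 2 = 0 ∨ i + 2 = 2) = decide (i = 0 ∨ i = 2)
  decide

theorem isUnderBool_turn_one (d : HalfEdge n) : isUnderBool (turn 1 d) = !isUnderBool d := by
  obtain ⟨c, i⟩ := d
  revert i
  show ∀ i : ZMod 4, decide (i + 1 = 0 ∨ i + 1 = 2) = !decide (i = 0 ∨ i = 2)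
  decide

theorem isUnderBool_turn_three (d : HalfEdge n) : isUnderBool (turn 3 d) = !isUnderBool d := by
  rw [← isUnderBool_turn_one, ← isUnderBool_turn_two (turn 1 d), turn_turn]
  rfl

variable {D}

theorem IsAlternating.isUnderBool_glue (halt : D.IsAlternating) (d : HalfEdge n) :
    isUnderBool (D.glue d) = !isUnderBool d := by
  have := halt d
  rw [← isUnderBool_iff, ← isUnderBool_iff] at this
  revert this
  cases isUnderBool (D.glue d) <;> cases isUnderBool d <;> simp

theorem IsAlternating.isUnderBool_walk (halt : D.IsAlternating) (d : HalfEdge n) :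
    isUnderBool (D.walk d) = !isUnderBool d := by
  rw [walk_apply, isUnderBool_turn_two, halt.isUnderBool_glue]

/-- The regions of an alternating diagram have a checkerboard colouring: the corners of a region
are either all to the left of outgoing lower half-edges or all to the left of outgoing upper
half-edges. -/
theorem IsAlternating.exists_color (halt : D.IsAlternating) :
    ∃ color : D.Region → Bool, ∀ d, color (D.region d) = isUnderBool d := by
  have step : ∀ d, isUnderBool (D.nextCorner d) = isUnderBool d := by
    intro d
    show isUnderBool (turn 3 (D.glue d)) = _
    rw [isUnderBool_turn_three, halt.isUnderBool_glue, Bool.not_not]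
  refine ⟨Quotient.lift (s := Equiv.Perm.SameCycle.setoid D.nextCorner) isUnderBool ?_,
    fun _ => rfl⟩
  rintro d _ ⟨k, rfl⟩
  induction k using Int.induction_on with
  | zero => rfl
  | succ k ih => rw [add_comm, zpow_add, zpow_one, Equiv.Perm.mul_apply, step, ih]
  | pred k ih =>
    rw [ih, ← step ((D.nextCorner ^ (-(k : ℤ) - 1)) d), ← Equiv.Perm.mul_apply, ← zpow_one_add]
    congr 3
    ring

variable (D)

/-- The relator squares of the crossing that a walk leaves by `d`, placed so that the labels of the
bottom and left sides are the regions on the two sides of the strand along which the walk arrives.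
The two values of `b` give reflections of each other. -/
def tile (b : Bool) (d : HalfEdge n) : Square D.Region :=
  if b then
    ⟨(D.region (turn 2 d), isUnderBool d), (D.region (turn 3 d), !isUnderBool d),
      (D.region d, !isUnderBool d), (D.region (turn 1 d), isUnderBool d)⟩
  else
    ⟨(D.region (turn 1 d), isUnderBool d), (D.region d, !isUnderBool d),
      (D.region (turn 3 d), !isUnderBool d), (D.region (turn 2 d), isUnderBool d)⟩

theorem tile_isRelatorSquare (b : Bool) (d : HalfEdge n) :
    (D.tile b d).IsRelatorSquare (D.relator d.1) := by
  obtain ⟨c, i⟩ := d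
  have key : (D.tile false (c, i)).IsRelatorSquare (D.relator c) := by
    have hi : i = 0 ∨ i = 1 ∨ i = 2 ∨ i = 3 := by revert i; decide
    rcases hi with rfl | rfl | rfl | rfl
    · exact .inl ⟨0, rfl⟩
    · exact .inl ⟨1, rfl⟩
    · exact .inl ⟨2, rfl⟩
    · exact .inl ⟨3, rfl⟩
  cases b
  · exact key
  · exact key.transpose

/-- Every relator square of a crossing is a tile: the four half-edges and the two reflections give
the eight drawings of the relator. -/
theorem exists_eq_tile {S : Square D.Region} {c : Fin n} (h : S.IsRelatorSquare (D.relator c)) :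
    ∃ b d, d.1 = c ∧ S = D.tile b d := by
  obtain ⟨s, a, t, l⟩ := S
  have key : ∀ {s a t l : D.Region × Bool}, (Square.mk s a t l).boundaryWord ~r D.relator c →
      ∃ b d, d.1 = c ∧ Square.mk s a t l = D.tile b d := by
    rintro ⟨s, s'⟩ ⟨a, a'⟩ ⟨t, t'⟩ ⟨l, l'⟩ h
    obtain ⟨m, hm⟩ := h.symm
    rw [← List.rotate_mod] at hm
    have hlt : m % 4 < 4 := Nat.mod_lt _ (by norm_num)
    change (D.relator c).rotate (m % 4) = _ at hm
    generalize m % 4 = m at hm hlt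
    interval_cases m <;>
      simp only [relator, Square.boundaryWord, List.rotate_cons_succ, List.rotate_zero,
        List.cons_append, List.nil_append, List.cons.injEq, Prod.mk.injEq, and_true,
        Bool.true_eq, Bool.false_eq, Bool.not_eq_true', Bool.not_eq_false'] at hm <;>
      obtain ⟨⟨rfl, rfl⟩, ⟨rfl, rfl⟩, ⟨rfl, rfl⟩, rfl, rfl⟩ := hm
    · exact ⟨false, (c, 0), rfl, rfl⟩
    · exact ⟨false, (c, 3), rfl, rfl⟩
    · exact ⟨false, (c, 2), rfl, rfl⟩
    · exact ⟨false, (c, 1), rfl, rfl⟩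
  rcases h with h | h
  · exact key h
  · have h' : (Square.mk l t a s).boundaryWord ~r D.relator c := by
      rw [Square.boundaryWord_transpose]
      simpa [FreeGroup.invRev_invRev] using h.invWord
    obtain ⟨b, d, hd, e⟩ := key h'
    refine ⟨!b, d, hd, ?_⟩
    cases b <;> simp only [tile, Square.mk.injEq, if_true, if_false, Bool.false_eq_true,
      Bool.not_true, Bool.not_false] at e ⊢ <;> tauto

variable {D}

/-- An edge is determined by the regions on its two sides, and one of its two half-edges by being
at the lower or the upper end. The half-edge in question is `turn 2 d`. -/
theorem IsPrime.halfEdge_ext (hprime : D.IsPrime) (halt : D.IsAlternating) {d d' : HalfEdge n}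
    (h2 : D.region (turn 2 d) = D.region (turn 2 d'))
    (h1 : D.region (turn 1 d) = D.region (turn 1 d')) (hu : isUnderBool d = isUnderBool d') :
    d = d' := by
  have hglue : ∀ d, D.region (D.glue (turn 2 d)) = D.region (turn 1 d) := by
    intro d
    rw [region_glue, turn_turn]
    rfl
  rcases hprime (turn 2 d) (turn 2 d') h2 (by rw [hglue, hglue, h1]) with h | h
  · exact ((turn 2).injective h).symm
  · have := congrArg isUnderBool h
    rw [halt.isUnderBool_glue, isUnderBool_turn_two, isUnderBool_turn_two, hu] at this
    simp at this

/-- The link of the vertex of the standard 2-complex: it is bipartite by the checkerboard colouring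
and has no double edges by primality. -/
theorem linkCondition_relator (hprime : D.IsPrime) (halt : D.IsAlternating) :
    LinkCondition (RelatorCorner D.relator) := by
  obtain ⟨color, hcolor⟩ := halt.exists_color
  have htile : ∀ {s t a b}, RelatorCorner D.relator s t a b →
      ∃ β d, Square.mk s a b t = D.tile β d := by
    rintro s t a b ⟨c, hc⟩
    obtain ⟨β, d, -, h⟩ := D.exists_eq_tile hc
    exact ⟨β, d, h⟩
  have hcorner : ∀ {s t a b}, RelatorCorner D.relator s t a b → color s.1 = !color t.1 := by
    intro s t a b h
    obtain ⟨β, d, h⟩ := htile h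
    cases β <;> simp only [tile, Square.mk.injEq, if_true, if_false, Bool.false_eq_true] at h <;>
      obtain ⟨rfl, -, -, rfl⟩ := h <;>
      simp [hcolor, isUnderBool_turn_one, isUnderBool_turn_two]
  refine ⟨RelatorCorner.symm, RelatorCorner.rot, ?_, ?_, ?_⟩
  · intro s t a b a' b' h h'
    obtain ⟨β, d, h⟩ := htile h
    obtain ⟨β', d', h'⟩ := htile h'
    have hcol : ∀ {β d a b}, Square.mk s a b t = D.tile β d → (β = true ↔ color s.1 = s.2) := by
      intro β d a b h
      cases β <;> simp only [tile, Square.mk.injEq, if_true, if_false, Bool.false_eq_true] at h <;>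
        obtain ⟨rfl, -, -, rfl⟩ := h <;>
        simp [hcolor, isUnderBool_turn_one, isUnderBool_turn_two]
    obtain rfl : β = β' := Bool.eq_iff_iff.2 ((hcol h).trans (hcol h').symm)
    have hd : d = d' := by
      cases β <;> simp only [tile, Square.mk.injEq, if_true, if_false, Bool.false_eq_true]
        at h h' <;> obtain ⟨rfl, -, -, rfl⟩ := h <;> obtain ⟨h1, -, -, h2⟩ := h' <;>
        rw [Prod.mk.injEq] at h1 h2
      · exact hprime.halfEdge_ext halt h2.1 h1.1 h1.2
      · exact hprime.halfEdge_ext halt h1.1 h2.1 h1.2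
    rw [hd, ← h', Square.mk.injEq] at h
    exact ⟨h.2.1, h.2.2.1⟩
  · rintro s t a b h rfl
    have := hcorner h
    simp at this
  · intro s t u a b c d e f h1 h2 h3
    have e1 := hcorner h1
    have e2 := hcorner h2
    have e3 := hcorner h3
    rw [e1, e2, Bool.not_not] at e3
    revert e3
    cases color u.1 <;> simp

/-- The right side of a tile fits to the reflected tile at the next crossing of the walk. -/
theorem IsAlternating.tile_right (halt : D.IsAlternating) (b : Bool) (d : HalfEdge n) :
    (D.tile b d).right = (D.tile (!b) (D.walk d)).left := by
  cases b <;> simp [tile, region_turn_two_walk, region_turn_one_walk, halt.isUnderBool_walk]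

theorem IsAlternating.tile_top (halt : D.IsAlternating) (b : Bool) (d : HalfEdge n) :
    (D.tile b d).top = (D.tile (!b) (D.walk d)).bottom := by
  cases b <;> simp [tile, region_turn_two_walk, region_turn_one_walk, halt.isUnderBool_walk]

theorem IsReduced.region_turn_two_ne (hred : D.IsReduced) (d : HalfEdge n) :
    D.region (turn 2 d) ≠ D.region d :=
  (hred d.1 d.2).symm

theorem IsReduced.region_turn_three_ne (hred : D.IsReduced) (d : HalfEdge n) :
    D.region (turn 3 d) ≠ D.region (turn 1 d) := by
  have h := hred.region_turn_two_ne (turn 1 d)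
  rwa [turn_turn] at h

/-- Consecutive bottom sides have different labels, namely regions which face each other across a
crossing. -/
theorem IsReduced.tile_bottom_ne (hred : D.IsReduced) (b : Bool) (d : HalfEdge n) :
    (D.tile (!b) (D.walk d)).bottom ≠ flipLetter (D.tile b d).bottom := by
  intro h
  have h := congrArg Prod.fst h
  cases b
  · simp [tile, region_turn_two_walk, flipLetter] at h
    exact hred.region_turn_three_ne d h
  · simp [tile, region_turn_one_walk, flipLetter] at h
    exact hred.region_turn_two_ne d h.symm

theorem IsReduced.tile_left_ne (hred : D.IsReduced) (b : Bool) (d : HalfEdge n) :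
    (D.tile (!b) (D.walk d)).left ≠ flipLetter (D.tile b d).left := by
  intro h
  have h := congrArg Prod.fst h
  cases b
  · simp [tile, region_turn_one_walk, flipLetter] at h
    exact hred.region_turn_two_ne d h.symm
  · simp [tile, region_turn_two_walk, flipLetter] at h
    exact hred.region_turn_three_ne d h

/-- A relator square of a crossing is determined by its left side: the colour of the region on
that side tells the reflection, and the opposite region at the crossing is a different one. -/
theorem IsReduced.eq_tile (hred : D.IsReduced) (halt : D.IsAlternating) {S : Square D.Region}
    {b : Bool} {d : HalfEdge n} (hS : S.IsRelatorSquare (D.relator d.1))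
    (hl : S.left = (D.tile b d).left) : S = D.tile b d := by
  obtain ⟨color, hcolor⟩ := halt.exists_color
  obtain ⟨b', d', hd, rfl⟩ := D.exists_eq_tile hS
  have hcol : ∀ b d, b = true ↔ color (D.tile b d).left.1 ≠ (D.tile b d).left.2 := by
    intro b d
    cases b <;> simp [tile, hcolor, isUnderBool_turn_one, isUnderBool_turn_two]
  obtain rfl : b' = b := Bool.eq_iff_iff.2 (by rw [hcol b' d', hl, ← hcol])
  have hu : isUnderBool d' = isUnderBool d := by
    have := congrArg Prod.snd hl
    cases b' <;> exact this
  have hdd : d' = d ∨ d' = turn 2 d := by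
    obtain ⟨c, i⟩ := d
    obtain ⟨c', i'⟩ := d'
    obtain rfl : c' = c := hd
    have : ∀ i i' : ZMod 4, decide (i' = 0 ∨ i' = 2) = decide (i = 0 ∨ i = 2) →
        i' = i ∨ i' = i + 2 := by decide
    exact (this i i' hu).imp (congrArg _) (congrArg _)
  rcases hdd with rfl | rfl
  · rfl
  · have := congrArg Prod.fst hl
    cases b'
    · refine (hred.region_turn_two_ne d ?_).elim
      rw [← turn_two_turn_two d]
      simpa [tile, turn_two_turn_two] using this.symm
    · refine (hred.region_turn_three_ne d ?_).elim
      simp only [tile, if_true, turn_turn] at this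
      exact this

end KnotDiagram

/-! ### The fundamental block and the peripheral plane -/

namespace KnotDiagram

variable {n : ℕ} {D : KnotDiagram n}

/-- The square at the time `k` of the walk, for all integers `k`. The reflection alternates. -/
def blockTile (D : KnotDiagram n) (b : Bool) (e : HalfEdge n) (k : ℤ) : Square D.Region :=
  D.tile (b ^^ decide (k % 2 = 1)) ((D.walk ^ k) e)

theorem blockTile_succ (b : Bool) (e : HalfEdge n) (k : ℤ) :
    D.blockTile b e (k + 1) =
      D.tile (!(b ^^ decide (k % 2 = 1))) (D.walk ((D.walk ^ k) e)) := by
  have h : decide ((k + 1) % 2 = 1) = !decide (k % 2 = 1) := by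
    rw [← decide_not]
    exact decide_eq_decide.2 (by omega)
  rw [blockTile, h, Bool.xor_not, add_comm k 1, zpow_one_add, Equiv.Perm.mul_apply]

theorem blockTile_natCast_zero (b : Bool) (e : HalfEdge n) :
    D.blockTile b e (0 : ℕ) = D.tile b e := by
  simp [blockTile]

theorem blockTile_isRelatorSquare (b : Bool) (e : HalfEdge n) (k : ℕ) :
    (D.blockTile b e k).IsRelatorSquare (D.relator (D.exitAt e k).1) := by
  have := D.tile_isRelatorSquare (b ^^ decide ((k : ℤ) % 2 = 1)) ((D.walk ^ (k : ℤ)) e)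
  rwa [zpow_natCast] at this

theorem blockTile_emod (b : Bool) (e : HalfEdge n) (k : ℤ) :
    D.blockTile b e (k % (2 * n : ℤ)) = D.blockTile b e k := by
  have h1 : k % (2 * n : ℤ) % 2 = k % 2 := Int.emod_emod_of_dvd _ ⟨n, rfl⟩
  have h2 : (D.walk ^ (k % (2 * n : ℤ))) e = (D.walk ^ k) e := by
    have h3 : ∀ m : ℤ, (D.walk ^ ((2 * n : ℤ) * m)) e = e := by
      intro m
      have : D.walk ^ (2 * n : ℤ) = D.walk ^ (2 * n) := by
        rw [← zpow_natCast]
        push_cast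
        rfl
      rw [zpow_mul, this]
      exact Function.IsFixedPt.perm_zpow (D.walk_pow_two_mul e) m
    conv_rhs => rw [← Int.emod_add_mul_ediv k (2 * n : ℤ), zpow_add, Equiv.Perm.mul_apply, h3]
  rw [blockTile, blockTile, h1, h2]

theorem natCast_blockIndex (hn : 0 < n) (i j : ℤ) :
    (blockIndex n i j : ℤ) = (i + j) % (2 * n : ℤ) :=
  Int.toNat_of_nonneg (Int.emod_nonneg _ (by omega))

theorem blockIndex_lt (hn : 0 < n) (i j : ℤ) : blockIndex n i j < 2 * n := by
  have h1 := natCast_blockIndex hn i j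
  have h2 := Int.emod_lt_of_pos (i + j) (b := 2 * n) (by omega)
  omega

/-- The first square is a relator square of the first crossing in one of two reflections. -/
theorem exists_eq_tile_of_mem_firstSquares {e : HalfEdge n} (he : e.IsUnder)
    {S : Square D.Region} (hS : S ∈ D.firstSquares e) : ∃ b, S = D.tile b e := by
  rw [← isUnderBool_iff] at he
  rcases hS with rfl | rfl
  · exact ⟨false, by simp [tile, he]⟩
  · exact ⟨true, by simp [tile, he]⟩

/-- A fundamental block is unique. -/
theorem IsFundamentalBlock.eq_blockTile (hred : D.IsReduced) (halt : D.IsAlternating)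
    {e : HalfEdge n} {b : Bool} {C : ℕ → Square D.Region}
    (hC : D.IsFundamentalBlock e (D.tile b e) C) {k : ℕ} (hk : k < 2 * n) :
    C k = D.blockTile b e k := by
  induction k with
  | zero => rw [hC.first, blockTile_natCast_zero]
  | succ k ih =>
    have hleft := hC.glued k hk
    rw [ih (by omega), blockTile, halt.tile_right] at hleft
    have hsq := hC.relatorSquare (k + 1) hk
    rw [Nat.cast_succ, blockTile_succ]
    refine hred.eq_tile halt ?_ hleft
    rw [exitAt, pow_succ', Equiv.Perm.mul_apply] at hsq
    rwa [zpow_natCast]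

theorem blockTile_isFundamentalBlock (halt : D.IsAlternating) (b : Bool) (e : HalfEdge n) :
    D.IsFundamentalBlock e (D.tile b e) (fun k => D.blockTile b e k) where
  first := blockTile_natCast_zero b e
  relatorSquare k _ := blockTile_isRelatorSquare b e k
  glued k _ := by
    rw [Nat.cast_succ, blockTile_succ, blockTile, halt.tile_right]

end KnotDiagram

theorem lemma2p6 (n : ℕ) (D : KnotDiagram n)
    (hred : D.IsReduced) (hprime : D.IsPrime) (halt : D.IsAlternating)
    (e : HalfEdge n) (he : e.IsUnder)
    (S : Square D.Region) (hS : S ∈ D.firstSquares e) :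
    -- the construction can be carried out
    (∃ C, D.IsFundamentalBlock e S C) ∧
    ∀ C, D.IsFundamentalBlock e S C →
      -- the copies of the block fit together to a tiling of the plane
      TilesFit (D.peripheralTiling C) ∧
      -- the peripheral complex embeds geodesically, by a map that keeps the labels
      (∃ f : TwoComplex.Hom (D.peripheralComplex C) (cayleyComplex D.relator),
        (∀ x, (coveringMap D.relator).onE (f.onE x) = (gridSide (D.peripheralTiling C) x).1) ∧
        (∀ i j, (coveringMap D.relator).onF (f.onF (i, j)) =
          (D.exitAt e (KnotDiagram.blockIndex n i j)).1) ∧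
        f.IsGeodesicEmbedding) ∧
      -- geodesic edge-paths are labelled by geodesic words
      ∀ u p v, (D.peripheralComplex C).IsGeodesic u p v →
        IsGeodesicWord D.relator (pathWord (D.peripheralTiling C) p) := by
  have hn : 0 < n := e.1.pos
  obtain ⟨b, rfl⟩ := KnotDiagram.exists_eq_tile_of_mem_firstSquares he hS
  refine ⟨⟨_, KnotDiagram.blockTile_isFundamentalBlock halt b e⟩, fun C hC => ?_⟩
  have hT : ∀ i j, D.peripheralTiling C i j = D.blockTile b e (i + j) := by
    intro i j
    rw [KnotDiagram.peripheralTiling, hC.eq_blockTile hred halt (KnotDiagram.blockIndex_lt hn i j),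
      KnotDiagram.natCast_blockIndex hn, KnotDiagram.blockTile_emod]
  have hfit : TilesFit (D.peripheralTiling C) := by
    intro i j
    rw [hT, hT, hT, add_right_comm, ← add_assoc, KnotDiagram.blockTile_succ]
    exact ⟨halt.tile_right _ _, halt.tile_top _ _⟩
  have hsq : ∀ i j, (D.peripheralTiling C i j).IsRelatorSquare
      (D.relator (D.exitAt e (KnotDiagram.blockIndex n i j)).1) :=
    fun i j => hC.relatorSquare _ (KnotDiagram.blockIndex_lt hn i j)
  have him : IsImmersed (D.peripheralTiling C) := by
    constructor <;> intro i j
    · have h : i + j = (i - 1 + j) + 1 := by ring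
      rw [hT, hT, h, KnotDiagram.blockTile_succ]
      exact hred.tile_bottom_ne _ _
    · have h : i + j = (i + (j - 1)) + 1 := by ring
      rw [hT, hT, h, KnotDiagram.blockTile_succ]
      exact hred.tile_left_ne _ _
  exact ⟨hfit, exists_isGeodesicEmbedding (KnotDiagram.linkCondition_relator hprime halt)
    (fun _ => rfl) hfit hsq him⟩
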